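/- **Setting.** Let $\mathbf C$ be an adhesive category (pushouts and pullbacks along monomorphisms exist, and pushouts along monomorphisms are van Kampen squares). A *final pullback complement* (FPC) of $A\xrightarrow{a}B\xrightarrow{c}E$ is a pair $A\xrightarrow{b}D\xrightarrow{d}E$ such that the square $ca=db$ is a pullback and such that for all $x:P\to B$, $y:P\to Q$, $z:Q\to E$, $w:P\to A$ with $(x,y)$ a pullback of $(c,z)$ and $aw=x$ there is a unique $t:Q\to D$ with $dt=z$ and $ty=bw$. Assume that $\mathbf C$ has epi-mono-factorizations, unique up to isomorphism; is balanced; has an object $\varnothing$ that admits exactly one monomorphism to every object and such that every morphism into $\varnothing$ is an isomorphism; has effective unions (if $B\leftarrow A\to B'$ is the pullback of monomorphisms $B\to E\leftarrow B'$, then the induced morphism from the pushout $B+_AB'$ to $E$ is a monomorphism); that every composable pair of monomorphisms $a,c$ has an FPC; and that, for such a pair, $d$ is again a monomorphism. **Conditions.** Conditions over an object $P$ are generated by $\mathsf{true}$, $\exists(a:P\hookrightarrow Q,\mathsf c_Q)$ with $a$ a monomorphism and $\mathsf c_Q$ a condition over $Q$, negation, and set-indexed conjunctions; $\mathsf{false}:=\neg\mathsf{true}$.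 A monomorphism $p:P\to H$ satisfies $\exists(a,\mathsf c_Q)$ if there is a monomorphism $q:Q\to H$ with $qa=p$ that satisfies $\mathsf c_Q$; the other cases are the obvious ones. Two conditions over $P$ are equivalent ($\equiv$) if the same monomorphisms out of $P$ satisfy them. * $\mathsf{Shift}(p,\mathsf c)$, for a monomorphism $p:P\to Q$ and a condition $\mathsf c$ over $P$, is the condition over $Q$ defined by recursion: it commutes with $\mathsf{true}$, $\neg$, $\bigwedge$, and $\mathsf{Shift}(p,\exists(a:P\to A,\mathsf c_A)):=\bigvee\exists(r:Q\to E,\mathsf{Shift}(s,\mathsf c_A))$, over the isomorphism classes of spans of monomorphisms $Q\xleftarrow{p''}X\xrightarrow{a''}A$ for which some monomorphism $x:P\to X$ has $p''x=p$, $a''x=a$; here $Q\xrightarrow{r}E\xleftarrow{s}A$ is the pushout of the span. * $\mathsf{Trans}(O\leftarrow K\to I,\mathsf c)$, for a span of monomorphisms and a condition $\mathsf c$ over $O$, is the condition over $I$ defined by recursion: it commutes with $\mathsf{true}$, $\neg$, $\bigwedge$, and $\mathsf{Trans}(O\leftarrow K\to I,\exists(a:O\to O',\mathsf c')):=\exists(I\to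 I',\mathsf{Trans}(O'\leftarrow K'\to I',\mathsf c'))$ if $K\to O\xrightarrow{a}O'$ has a pushout complement $K\to K'\to O'$, with $I'$ the pushout of $I\leftarrow K\to K'$, and $\mathsf{false}$ otherwise. **Rules and composition.** A linear rule with application condition is $R=(r,\mathsf c_I)$ with $r=(O\leftarrow K\to I)$ a span of monomorphisms and $\mathsf c_I$ a condition over $I$. Rules $r,r'$ are isomorphic if there are isomorphisms $\omega:O\to O'$, $\kappa:K\to K'$, $\iota:I\to I'$ commuting with the legs. Given $R_1,R_2$ and a span of monomorphisms $\mu=(I_2\xleftarrow{m_2}M\xrightarrow{m_1}O_1)$, let $N$ be its pushout, let $K_1\to K_1'\to N$ be a pushout complement of $K_1\to O_1\to N$ (if there is one), $I_{21}$ the pushout of $I_1\leftarrow K_1\to K_1'$, $K_2\to K_2'\to N$ the FPC of $K_2\to I_2\to N$, $O_{21}$ the pushout of $O_2\leftarrow K_2\to K_2'$, and $K_{21}=K_2'\times_NK_1'$. If the pushout complement exists and $$\mathsf c_{I_{21}}:=\mathsf{Shift}(I_1\to I_{21},\mathsf c_{I_1})\wedge\mathsf{Trans}\big(N\leftarrow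 K_1'\to I_{21},\mathsf{Shift}(I_2\to N,\mathsf c_{I_2})\big)\not\equiv\mathsf{false},$$ then $\mu$ is an *SqPO-admissible match* of $R_2$ into $R_1$, and its composite is $R_2\triangleleft_\mu R_1:=(O_{21}\leftarrow K_{21}\to I_{21},\ \mathsf c_{I_{21}})$, which is well defined up to isomorphism. Write $\mathsf M_{R_2}(R_1)$ for the set of isomorphism classes of SqPO-admissible matches of $R_2$ into $R_1$ (two spans being isomorphic if an isomorphism of their apex objects commutes with the legs). **Theorem (SqPO-type Associativity Theorem).** Let $R_1,R_2,R_3$ be linear rules with application conditions in $\mathbf C$, and put $$M_A:=\{(\mu_{21},\mu_{3(21)})\mid \mu_{21}\in\mathsf M_{R_2}(R_1),\ \mu_{3(21)}\in\mathsf M_{R_3}(R_2\triangleleft_{\mu_{21}}R_1)\},$$ $$M_B:=\{(\mu_{32},\mu_{(32)1})\mid \mu_{32}\in\mathsf M_{R_3}(R_2),\ \mu_{(32)1}\in\mathsf M_{R_3\triangleleft_{\mu_{32}}R_2}(R_1)\}.$$ Then there is a bijection $M_A\to M_B$ such that, whenever $(\mu_{21},\mu_{3(21)})$ corresponds to $(\mu_{32},\mu_{(32)1})$,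 there is an isomorphism of the underlying linear rules of $$R_3\triangleleft_{\mu_{3(21)}}(R_2\triangleleft_{\mu_{21}}R_1)\quad\text{and}\quad(R_3\triangleleft_{\mu_{32}}R_2)\triangleleft_{\mu_{(32)1}}R_1$$ whose component $\iota:I_{3(21)}\to I_{(32)1}$ on inputs identifies their application conditions up to equivalence: for every monomorphism $q$ out of $I_{(32)1}$, $q\circ\iota$ satisfies $\mathsf c_{I_{3(21)}}$ if and only if $q$ satisfies $\mathsf c_{I_{(32)1}}$. -/

import Mathlib

open CategoryTheory CategoryTheory.Limits

universe v u

namespace SqPO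

section Assumptions

/-- The square `a ≫ c = b ≫ d` exhibits `(d, b)` as a final pullback complement of the
composable pair `(c, a)`:
```
    A --a--> B
    |b       |c
    D --d--> E
```
it is a pullback, and every pullback `(x, y)` of `c` along some `z : Q ⟶ E` whose leg `x`
factors through `a` is induced by a unique morphism `Q ⟶ D`. -/
structure IsFPC {C : Type u} [Category.{v} C] {A B D E : C}
    (a : A ⟶ B) (c : B ⟶ E) (b : A ⟶ D) (d : D ⟶ E) : Prop where
  isPullback : IsPullback a b c d
  exists_unique : ∀ {P Q : C} (x : P ⟶ B) (y : P ⟶ Q) (z : Q ⟶ E) (w : P ⟶ A),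
    IsPullback x y c z → w ≫ a = x → ∃! t : Q ⟶ D, t ≫ d = z ∧ y ≫ t = w ≫ b

/-- `f = e ≫ m` is a factorization of `f` into an epimorphism and a monomorphism. -/
def IsEpiMonoFactorization {C : Type u} [Category.{v} C] {A B E : C}
    (f : A ⟶ B) (e : A ⟶ E) (m : E ⟶ B) : Prop :=
  Epi e ∧ Mono m ∧ e ≫ m = f

/-- The assumptions on a category for associative SqPO rewriting with conditions, in addition to
adhesivity; the distinguished class of monomorphisms is the class of all monomorphisms. -/
structure Assumptions (C : Type u) [Category.{v} C] : Prop where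
  /-- every morphism has an epi-mono-factorization ... -/
  factorization_exists : ∀ {A B : C} (f : A ⟶ B),
    ∃ (E : C) (e : A ⟶ E) (m : E ⟶ B), IsEpiMonoFactorization f e m
  /-- ... which is unique up to isomorphism -/
  factorization_unique : ∀ {A B E E₁ : C} (f : A ⟶ B) (e : A ⟶ E) (m : E ⟶ B)
    (e₁ : A ⟶ E₁) (m₁ : E₁ ⟶ B), IsEpiMonoFactorization f e m → IsEpiMonoFactorization f e₁ m₁ →
      ∃ φ : E ≅ E₁, e ≫ φ.hom = e₁ ∧ φ.hom ≫ m₁ = m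
  /-- the category is balanced -/
  balanced : Balanced C
  /-- there is a strict initial object, initial with respect to monomorphisms -/
  strict_initial : ∃ Z : C, (∀ A : C, ∃! i : Z ⟶ A, Mono i) ∧ ∀ (X : C) (f : X ⟶ Z), IsIso f
  /-- unions of subobjects are effective -/
  effective_unions : ∀ {A B B₁ D E : C} (b₀ : A ⟶ B) (c₀ : A ⟶ B₁) (e : B ⟶ D) (f : B₁ ⟶ D)
    (b : B ⟶ E) (c : B₁ ⟶ E) (d : D ⟶ E), Mono b₀ → Mono c₀ → Mono e → Mono f → Mono b → Mono c →
      IsPushout b₀ c₀ e f → IsPullback b₀ c₀ b c → e ≫ d = b → f ≫ d = c → Mono d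
  /-- final pullback complements of composable pairs of monomorphisms exist ... -/
  fpc_exists : ∀ {A B E : C} (a : A ⟶ B) (c : B ⟶ E), Mono a → Mono c →
    ∃ (D : C) (b : A ⟶ D) (d : D ⟶ E), IsFPC a c b d
  /-- ... and monomorphisms are stable under them -/
  fpc_stable : ∀ {A B D E : C} (a : A ⟶ B) (c : B ⟶ E) (b : A ⟶ D) (d : D ⟶ E),
    Mono a → Mono c → IsFPC a c b d → Mono d

end Assumptions

section Conditions

/-- Nested conditions over an object `P`. -/
inductive Condition {C : Type u} [Category.{v} C] : C → Type (max u v + 1)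
  | tt (P : C) : Condition P
  | ex {P Q : C} (a : P ⟶ Q) (ha : Mono a) (c : Condition Q) : Condition P
  | neg {P : C} (c : Condition P) : Condition P
  | conj {P : C} (ι : Type (max u v)) (c : ι → Condition P) : Condition P

namespace Condition

variable {C : Type u} [Category.{v} C]

/-- The condition `false`. -/
def ff (P : C) : Condition P := neg (tt P)

/-- Disjunction of a family of conditions. -/
def disj {P : C} (ι : Type (max u v)) (c : ι → Condition P) : Condition P :=
  neg (conj ι fun i => neg (c i))

/-- Conjunction of two conditions. -/
def and {P : C} (c₁ c₂ : Condition P) : Condition P :=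
  conj (ULift Bool) fun j => cond j.down c₁ c₂

/-- `c.Sat p`: the monomorphism `p : P ⟶ H` satisfies the condition `c` over `P`. -/
def Sat : {P : C} → Condition P → {H : C} → (P ⟶ H) → Prop
  | _, tt _, _, _ => True
  | _, @ex _ _ _ Q a _ c, H, p => ∃ q : Q ⟶ H, Mono q ∧ a ≫ q = p ∧ c.Sat q
  | _, neg c, _, p => ¬ c.Sat p
  | _, conj ι c, _, p => ∀ i : ι, (c i).Sat p

/-- Equivalence of conditions over `P`. -/
def Equivalent {P : C} (c₁ c₂ : Condition P) : Prop :=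
  ∀ (H : C) (p : P ⟶ H), Mono p → (c₁.Sat p ↔ c₂.Sat p)

/-- Equivalence of conditions over isomorphic objects, along an isomorphism of these objects. -/
def EquivalentAlong {P Q : C} (ι : P ≅ Q) (c₁ : Condition P) (c₂ : Condition Q) : Prop :=
  ∀ (H : C) (q : Q ⟶ H), Mono q → (c₁.Sat (ι.hom ≫ q) ↔ c₂.Sat q)

end Condition

end Conditions

section Shift

variable {C : Type u} [Category.{v} C]

/-- A span of monomorphisms `Q ⟵ X ⟶ A` under `P`, for given `p : P ⟶ Q` and `a : P ⟶ A`. -/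
structure Overlap {P Q A : C} (p : P ⟶ Q) (a : P ⟶ A) where
  X : C
  x : P ⟶ X
  toQ : X ⟶ Q
  toA : X ⟶ A
  mono_x : Mono x
  mono_toQ : Mono toQ
  mono_toA : Mono toA
  x_toQ : x ≫ toQ = p
  x_toA : x ≫ toA = a

attribute [instance] Overlap.mono_x Overlap.mono_toQ Overlap.mono_toA

/-- Isomorphism of spans, induced by an isomorphism of the apex objects. -/
def Overlap.setoid {P Q A : C} (p : P ⟶ Q) (a : P ⟶ A) : Setoid (Overlap p a) where
  r S T := ∃ φ : S.X ≅ T.X, φ.hom ≫ T.toQ = S.toQ ∧ φ.hom ≫ T.toA = S.toA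
  iseqv :=
    { refl := fun S => ⟨Iso.refl _, by simp, by simp⟩
      symm := by
        rintro S T ⟨φ, h₁, h₂⟩
        exact ⟨φ.symm, by simp [← h₁], by simp [← h₂]⟩
      trans := by
        rintro S T U ⟨φ, h₁, h₂⟩ ⟨ψ, h₃, h₄⟩
        exact ⟨φ ≪≫ ψ, by simp [h₁, h₃], by simp [h₂, h₄]⟩ }

/-- The shift of a condition `c` over `P` along `p : P ⟶ Q`. For `c = ∃(a : P ⟶ A, c')` it is the
disjunction, over isomorphism classes of spans of monomorphisms `Q ⟵ X ⟶ A` under `P`, of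
`∃(r, shift c' s)`, with `Q --r--> E <--s-- A` the pushout of the span. -/
noncomputable def shift [Adhesive C] : {P : C} → Condition P → {Q : C} → (P ⟶ Q) → Condition Q
  | _, .tt _, Q, _ => .tt Q
  | _, .ex a _ c, _, p =>
      .disj (Quotient (Overlap.setoid p a)) fun S =>
        .ex (pushout.inl S.out.toQ S.out.toA)
          (Adhesive.mono_of_isPushout_of_mono_right (IsPushout.of_hasPushout S.out.toQ S.out.toA))
          (shift c (pushout.inr S.out.toQ S.out.toA))
  | _, .neg c, _, p => .neg (shift c p)
  | _, .conj ι c, _, p => .conj ι fun i => shift (c i) p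

end Shift

section Rules

variable {C : Type u} [Category.{v} C]

variable (C) in
/-- A (representative of a) linear rule: a span of monomorphisms `O ⟵ K ⟶ I`. -/
structure LinRule where
  O : C
  K : C
  I : C
  o : K ⟶ O
  i : K ⟶ I
  mono_o : Mono o
  mono_i : Mono i

attribute [instance] LinRule.mono_o LinRule.mono_i

/-- Isomorphisms of linear rules. -/
structure LinRule.Iso (r s : LinRule C) where
  ω : r.O ≅ s.O
  κ : r.K ≅ s.K
  ι : r.I ≅ s.I
  w_o : r.o ≫ ω.hom = κ.hom ≫ s.o
  w_i : r.i ≫ ι.hom = κ.hom ≫ s.i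

variable (C) in
/-- A linear rule with an application condition in standard form, i.e. over its input. -/
structure RuleAC extends LinRule C where
  cI : Condition I

end Rules

section Transport

variable {C : Type u} [Category.{v} C]

/-- A pushout complement of the composable pair `o : K ⟶ O`, `a : O ⟶ O'`. -/
structure PushoutComplement {K O P : C} (o : K ⟶ O) (a : O ⟶ P) where
  L : C
  k : K ⟶ L
  l : L ⟶ P
  isPushout : IsPushout o k a l

theorem PushoutComplement.mono_k [Adhesive C] {K O P : C} {o : K ⟶ O} {a : O ⟶ P}
    (D : PushoutComplement o a) (ho : Mono o) (ha : Mono a) : Mono D.k :=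
  (Adhesive.isPullback_of_isPushout_of_mono_left D.isPushout).mono_snd_of_mono

theorem PushoutComplement.mono_l [Adhesive C] {K O P : C} {o : K ⟶ O} {a : O ⟶ P}
    (D : PushoutComplement o a) (ho : Mono o) : Mono D.l :=
  Adhesive.mono_of_isPushout_of_mono_left D.isPushout

open Classical in
/-- The transport of a condition `c` over `O` along the span of monomorphisms `O ⟵ K ⟶ I`.
For `c = ∃(a : O ⟶ O', c')` it is `false` if `K ⟶ O ⟶ O'` has no pushout complement `K ⟶ K' ⟶ O'`;
otherwise it is `∃(I ⟶ I', c'')` with `I'` the pushout of `I ⟵ K ⟶ K'` and `c''` the transport of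
`c'` along `O' ⟵ K' ⟶ I'`. -/
noncomputable def trans [Adhesive C] : {O : C} → Condition O → {K I : C} →
    (o : K ⟶ O) → (i : K ⟶ I) → Mono o → Mono i → Condition I
  | _, .tt _, _, I, _, _, _, _ => .tt I
  | _, .ex a ha c, _, I, o, i, ho, _ =>
      if h : Nonempty (PushoutComplement o a) then
        .ex (pushout.inl i h.some.k)
          (@Adhesive.mono_of_isPushout_of_mono_right _ _ _ _ _ _ _ _ _ _ _
            (IsPushout.of_hasPushout i h.some.k) (h.some.mono_k ho ha))
          (trans c h.some.l (pushout.inr i h.some.k) (h.some.mono_l ho)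
            (Adhesive.mono_of_isPushout_of_mono_left (IsPushout.of_hasPushout i h.some.k)))
      else .ff I
  | _, .neg c, _, _, o, i, ho, hi => .neg (trans c o i ho hi)
  | _, .conj ι c, _, _, o, i, ho, hi => .conj ι fun j => trans (c j) o i ho hi

end Transport

section Composition

variable {C : Type u} [Category.{v} C]

/-- Monomorphisms are stable under final pullback complements. -/
theorem IsFPC.mono [Adhesive C] {A B D E : C} {a : A ⟶ B} {c : B ⟶ E} {b : A ⟶ D} {d : D ⟶ E}
    (h : IsFPC a c b d) (ha : Mono a) (hc : Mono c) : Mono d := by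
  constructor
  intro Q s t hst
  have hP := IsPullback.of_hasPullback c (s ≫ d)
  have hs : pullback.fst c (s ≫ d) ≫ c = (pullback.snd c (s ≫ d) ≫ s) ≫ d := by
    rw [hP.w, Category.assoc]
  have ht : pullback.fst c (s ≫ d) ≫ c = (pullback.snd c (s ≫ d) ≫ t) ≫ d :=
    hP.w.trans ((pullback.snd c (s ≫ d) ≫= hst).trans (Category.assoc _ _ _).symm)
  have hw : h.isPullback.lift _ _ hs = h.isPullback.lift _ _ ht := by
    rw [← cancel_mono a]; simp
  refine (h.exists_unique _ _ _ (h.isPullback.lift _ _ hs) hP (by simp)).unique ⟨rfl, ?_⟩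
    ⟨hst.symm, ?_⟩
  · simp
  · rw [hw]; simp

/-- A span of monomorphisms `I₂ ⟵ M ⟶ O₁`, from the input of `R₂` to the output of `R₁`. -/
structure MatchSpan (R₂ R₁ : RuleAC C) where
  M : C
  m₂ : M ⟶ R₂.I
  m₁ : M ⟶ R₁.O
  mono_m₂ : Mono m₂
  mono_m₁ : Mono m₁

attribute [instance] MatchSpan.mono_m₂ MatchSpan.mono_m₁

/-- A diagram constructed from the span `μ` for the composition of `R₂` with `R₁`:
```
  O₂ <------ K₂ ------> I₂ <-- M --> O₁ <------ K₁ ------> I₁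
  |    PO    |    FPC     \    PO    /    POC   |    PO    |
  O₂₁ <----- L₂ ---------->    N    <---------- L₁ -----> I₂₁
```
and the pullback `L₂ <-- K₂₁ --> L₁` of `L₂ --> N <-- L₁`. -/
structure CompositionDiagram {R₂ R₁ : RuleAC C} (μ : MatchSpan R₂ R₁) where
  N : C
  I₂N : R₂.I ⟶ N
  O₁N : R₁.O ⟶ N
  isPushout_N : IsPushout μ.m₂ μ.m₁ I₂N O₁N
  L₁ : C
  k₁ : R₁.K ⟶ L₁
  L₁N : L₁ ⟶ N
  /-- `L₁` is a pushout complement of `K₁ ⟶ O₁ ⟶ N` -/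
  isPOC : IsPushout R₁.o k₁ O₁N L₁N
  I₂₁ : C
  p₁ : R₁.I ⟶ I₂₁
  L₁I₂₁ : L₁ ⟶ I₂₁
  isPushout_I₂₁ : IsPushout R₁.i k₁ p₁ L₁I₂₁
  L₂ : C
  k₂ : R₂.K ⟶ L₂
  L₂N : L₂ ⟶ N
  /-- `L₂` is the final pullback complement of `K₂ ⟶ I₂ ⟶ N` -/
  isFPC : IsFPC R₂.i I₂N k₂ L₂N
  O₂₁ : C
  q₂ : R₂.O ⟶ O₂₁
  L₂O₂₁ : L₂ ⟶ O₂₁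
  isPushout_O₂₁ : IsPushout R₂.o k₂ q₂ L₂O₂₁
  K₂₁ : C
  K₂₁L₂ : K₂₁ ⟶ L₂
  K₂₁L₁ : K₂₁ ⟶ L₁
  isPullback_K₂₁ : IsPullback K₂₁L₂ K₂₁L₁ L₂N L₁N

namespace CompositionDiagram

variable [Adhesive C] {R₂ R₁ : RuleAC C} {μ : MatchSpan R₂ R₁} (D : CompositionDiagram μ)

theorem mono_L₁N : Mono D.L₁N := Adhesive.mono_of_isPushout_of_mono_left D.isPOC

theorem mono_L₁I₂₁ : Mono D.L₁I₂₁ := Adhesive.mono_of_isPushout_of_mono_left D.isPushout_I₂₁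

theorem mono_L₂O₂₁ : Mono D.L₂O₂₁ := Adhesive.mono_of_isPushout_of_mono_left D.isPushout_O₂₁

theorem mono_L₂N : Mono D.L₂N :=
  D.isFPC.mono R₂.mono_i (Adhesive.mono_of_isPushout_of_mono_right D.isPushout_N)

theorem mono_K₂₁L₂ : Mono D.K₂₁L₂ := by
  have := D.mono_L₁N
  exact D.isPullback_K₂₁.flip.mono_snd_of_mono

theorem mono_K₂₁L₁ : Mono D.K₂₁L₁ := by
  have := D.mono_L₂N
  exact D.isPullback_K₂₁.mono_snd_of_mono

/-- The rule with application condition produced by the diagram: the span `O₂₁ ⟵ K₂₁ ⟶ I₂₁` with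
`Shift(I₁ ⟶ I₂₁, c₁) ∧ Trans(N ⟵ L₁ ⟶ I₂₁, Shift(I₂ ⟶ N, c₂))`. -/
noncomputable def composite : RuleAC C where
  O := D.O₂₁
  K := D.K₂₁
  I := D.I₂₁
  o := D.K₂₁L₂ ≫ D.L₂O₂₁
  i := D.K₂₁L₁ ≫ D.L₁I₂₁
  mono_o := @mono_comp _ _ _ _ _ _ D.mono_K₂₁L₂ _ D.mono_L₂O₂₁
  mono_i := @mono_comp _ _ _ _ _ _ D.mono_K₂₁L₁ _ D.mono_L₁I₂₁
  cI := .and (shift R₁.cI D.p₁)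
    (trans (shift R₂.cI D.I₂N) D.L₁N D.L₁I₂₁ D.mono_L₁N D.mono_L₁I₂₁)

end CompositionDiagram

/-- A span `μ` is SqPO-admissible if the diagram is constructible and the resulting condition is
not equivalent to `false`. -/
def IsAdmissible [Adhesive C] {R₂ R₁ : RuleAC C} (μ : MatchSpan R₂ R₁) : Prop :=
  ∃ D : CompositionDiagram μ, ¬ D.composite.cI.Equivalent (.ff D.composite.I)

/-- Isomorphism of (admissible) spans, induced by an isomorphism of the apex objects. -/
def admissibleSetoid [Adhesive C] (R₂ R₁ : RuleAC C) :
    Setoid {μ : MatchSpan R₂ R₁ // IsAdmissible μ} where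
  r μ ν := ∃ φ : μ.1.M ≅ ν.1.M, φ.hom ≫ ν.1.m₂ = μ.1.m₂ ∧ φ.hom ≫ ν.1.m₁ = μ.1.m₁
  iseqv :=
    { refl := fun μ => ⟨Iso.refl _, by simp, by simp⟩
      symm := by
        rintro μ ν ⟨φ, h₁, h₂⟩
        exact ⟨φ.symm, by simp [← h₁], by simp [← h₂]⟩
      trans := by
        rintro μ ν ξ ⟨φ, h₁, h₂⟩ ⟨ψ, h₃, h₄⟩
        exact ⟨φ ≪≫ ψ, by simp [h₁, h₃], by simp [h₂, h₄]⟩ }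

/-- The set of SqPO-admissible matches of `R₂` into `R₁`: isomorphism classes of admissible
spans. -/
def AdmissibleMatch [Adhesive C] (R₂ R₁ : RuleAC C) : Type (max u v) :=
  Quotient (admissibleSetoid R₂ R₁)

/-- The composite of `R₂` with `R₁` along an SqPO-admissible match. It is defined up to
isomorphism; the definition picks a representative. -/
noncomputable def comp [Adhesive C] (R₂ R₁ : RuleAC C) (μ : AdmissibleMatch R₂ R₁) : RuleAC C :=
  (Quotient.out μ).2.choose.composite

/-- The set of pairs `(μ₂₁, μ₃₍₂₁₎)`. -/
abbrev MatchesA [Adhesive C] (R₃ R₂ R₁ : RuleAC C) : Type (max u v) :=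
  Σ μ₂₁ : AdmissibleMatch R₂ R₁, AdmissibleMatch R₃ (comp R₂ R₁ μ₂₁)

/-- The set of pairs `(μ₃₂, μ₍₃₂₎₁)`. -/
abbrev MatchesB [Adhesive C] (R₃ R₂ R₁ : RuleAC C) : Type (max u v) :=
  Σ μ₃₂ : AdmissibleMatch R₃ R₂, AdmissibleMatch (comp R₃ R₂ μ₃₂) R₁

end Composition

end SqPO

/-! Both composites describe the same data. A trace on `H` consists of a match of the first rule
into `H`, a rewriting step there, a match of the second rule into the result, a second step, and a
match of the third rule into what it yields. It is satisfying if all three matches satisfy their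
application conditions. Neither bracketing occurs in this notion.

The link is a concurrency principle for two rules. Given a step by `R₁` and a match of `R₂` into its
result, pulling the match back against the comatch recovers the overlap `μ`, and the composition
diagram of `μ` embeds into the step. Conversely, a monomorphism `I₂₁ ⟶ H` restricts to a match of
`R₁` and, once a step there is fixed, induces the match of `R₂`. Under this correspondence the
composite condition says that both matches satisfy theirs (`CompositionDiagram.Emb.sat_iff`, resting
on `sat_shift` and `sat_trans`), and the two steps compose to a step of the composite rule
(`CompositionDiagram.Emb.comp`).

Applied twice, in either bracketing, this makes every satisfying trace contain exactly one member of
`MatchesA` and exactly one of `MatchesB`. Every monomorphism out of a composite input comes from a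
trace, unique up to isomorphism. Two members correspond when they embed into a common trace.
Admissibility supplies a satisfying trace, hence a partner. Functoriality in traces makes the
partner unique and embeds the inputs into each other by mutually inverse maps. Both conditions then
express satisfaction of the same trace.

For the rules themselves, apply `R₃` at the end of the trace on the common input. Both composites
yield three-step derivations whose middle objects are the two bracketings of an iterated pullback;
since a step along an isomorphism reproduces its rule, associativity of pullbacks gives the
isomorphism. -/

namespace SqPO

/-! ### Final pullback complements and pushouts in adhesive categories -/

section FinalPullbackComplements

variable {C : Type u} [Category.{v} C]

theorem isPullback_of_mono {A B D E : C} {a : A ⟶ B} {b : A ⟶ D} {c : B ⟶ E} {d : D ⟶ E}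
    [Mono a] [Mono d] (w : a ≫ c = b ≫ d)
    (h : ∀ {W : C} (x : W ⟶ B) (y : W ⟶ D), x ≫ c = y ≫ d → ∃ t : W ⟶ A, t ≫ a = x) :
    IsPullback a b c d := by
  refine ⟨⟨w⟩, ⟨PullbackCone.IsLimit.mk w (fun s => (h s.fst s.snd s.condition).choose) ?_ ?_ ?_⟩⟩
  · intro s
    exact (h s.fst s.snd s.condition).choose_spec
  · intro s
    rw [← cancel_mono d, Category.assoc, ← w, ← s.condition, ← Category.assoc,
      (h s.fst s.snd s.condition).choose_spec]
  · intro s m h₁ _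
    rw [← cancel_mono a, h₁, (h s.fst s.snd s.condition).choose_spec]

theorem isPullback_comp_mono {A B D E F : C} {a : A ⟶ B} {b : A ⟶ D} {c : B ⟶ E} {d : D ⟶ E}
    (h : IsPullback a b c d) (e : E ⟶ F) [Mono e] : IsPullback a b (c ≫ e) (d ≫ e) := by
  refine ⟨⟨h.w_assoc e⟩, ⟨PullbackCone.IsLimit.mk _
    (fun s => h.lift s.fst s.snd ?_) ?_ ?_ ?_⟩⟩
  · rw [← cancel_mono e]
    simpa using s.condition
  · intro s; simp
  · intro s; simp
  · intro s m h₁ h₂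
    apply h.hom_ext <;> simp [h₁, h₂]

theorem isPullback_of_comp_mono {A B D E F : C} {a : A ⟶ B} {b : A ⟶ D} {c : B ⟶ E} {d : D ⟶ E}
    {e : E ⟶ F} [Mono e] (h : IsPullback a b (c ≫ e) (d ≫ e)) : IsPullback a b c d := by
  have w : a ≫ c = b ≫ d := by
    rw [← cancel_mono e]
    simpa using h.w
  refine ⟨⟨w⟩, ⟨PullbackCone.IsLimit.mk _
    (fun s => h.lift s.fst s.snd (by simp only [← Category.assoc, s.condition])) ?_ ?_ ?_⟩⟩
  · intro s; simp
  · intro s; simp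
  · intro s m h₁ h₂
    apply h.hom_ext <;> simp [h₁, h₂]

/-- Since `d` is monic, uniqueness of the mediating morphism and its compatibility with `y` are
automatic; only a factorization of `z` through `d` has to be found. -/
theorem IsFPC.of_mono {A B D E : C} {a : A ⟶ B} {c : B ⟶ E} {b : A ⟶ D} {d : D ⟶ E}
    [Mono d] (h : IsPullback a b c d)
    (ht : ∀ {P Q : C} (w : P ⟶ A) (y : P ⟶ Q) (z : Q ⟶ E), IsPullback (w ≫ a) y c z →
      ∃ t : Q ⟶ D, t ≫ d = z) : IsFPC a c b d where
  isPullback := h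
  exists_unique := by
    rintro P Q x y z w hP rfl
    obtain ⟨t, ht⟩ := ht w y z hP
    refine ⟨t, ⟨ht, ?_⟩, fun t' ht' => ?_⟩
    · rw [← cancel_mono d, Category.assoc, ht, Category.assoc, ← h.w, ← hP.w, Category.assoc]
    · rw [← cancel_mono d, ht, ht'.1]

theorem IsFPC.exists_lift {A B D E P Q : C} {a : A ⟶ B} {c : B ⟶ E} {b : A ⟶ D} {d : D ⟶ E}
    (h : IsFPC a c b d) (w : P ⟶ A) (y : P ⟶ Q) (z : Q ⟶ E) (hP : IsPullback (w ≫ a) y c z) :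
    ∃ t : Q ⟶ D, t ≫ d = z ∧ y ≫ t = w ≫ b :=
  (h.exists_unique _ y z w hP rfl).exists

/-- The test object is lifted in two stages, first to `D` and then to `D'`; pullback cancellation
turns the original test square into one for the second complement. -/
theorem IsFPC.comp {A' A B D' D E : C} {a : A ⟶ B} {c : B ⟶ E} {b : A ⟶ D} {d : D ⟶ E}
    {a' : A' ⟶ A} {b' : A' ⟶ D'} {d' : D' ⟶ D} [Mono d] [Mono d'] (F : IsFPC a c b d)
    (F' : IsFPC a' b b' d') : IsFPC (a' ≫ a) c b' (d' ≫ d) := by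
  refine IsFPC.of_mono (F'.isPullback.flip.paste_vert F.isPullback.flip).flip
    fun {P Q} w y z hP => ?_
  obtain ⟨t, ht, hyt⟩ := F.exists_lift (w ≫ a') y z (by simpa using hP)
  have h₁ : IsPullback (w ≫ a') y b t := by
    refine (IsPullback.of_bot (v₂₁ := a) (h₃₁ := c) (v₂₂ := d) ?_ hyt F.isPullback.flip).flip
    rw [ht]
    simpa using hP.flip
  obtain ⟨t', ht', -⟩ := F'.exists_lift w y t h₁
  exact ⟨t', by rw [← Category.assoc, ht', ht]⟩

/-- Final pullback complements are stable under base change. -/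
theorem IsFPC.baseChange {A B D E A' B' D' E' : C} {a : A ⟶ B} {c : B ⟶ E} {b : A ⟶ D}
    {d : D ⟶ E} [Mono a] [Mono d] (F : IsFPC a c b d) {a' : A' ⟶ A} {c' : B' ⟶ E'}
    {eA : A' ⟶ B'} {eB : B' ⟶ B} {eD : D' ⟶ D} {e : E' ⟶ E} {b' : A' ⟶ D'} {d' : D' ⟶ E'}
    (hB : IsPullback eB c' c e) (hD : IsPullback eD d' d e) (hA : IsPullback a' eA a eB)
    (h₁ : eA ≫ c' = b' ≫ d') : IsFPC eA c' b' d' := by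
  have : Mono eA := hA.mono_snd_of_mono
  have : Mono d' := hD.mono_snd_of_mono
  refine IsFPC.of_mono (isPullback_of_mono h₁ fun {W} x y hxy => ?_) fun {P Q} w y z hP => ?_
  · have h₂ : (x ≫ eB) ≫ c = (y ≫ eD) ≫ d := by
      rw [Category.assoc, hB.w, Category.assoc, hD.w, ← Category.assoc, hxy, Category.assoc]
    exact ⟨hA.lift (F.isPullback.lift _ _ h₂) x (by simp), by simp⟩
  · obtain ⟨t, ht, -⟩ := F.exists_lift (w ≫ a') y (z ≫ e) (by
      simpa [hA.w] using hP.paste_horiz hB)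
    exact ⟨hD.lift t z ht, by simp⟩

variable [Adhesive C]

/-- The van Kampen property: pushouts along monomorphisms are stable under pullback. -/
theorem isPushout_of_isPullback {W X Y Z W' X' Y' Z' : C} {f : W ⟶ X} {g : W ⟶ Y} {h : X ⟶ Z}
    {i : Y ⟶ Z} {f' : W' ⟶ X'} {g' : W' ⟶ Y'} {h' : X' ⟶ Z'} {i' : Y' ⟶ Z'} {αW : W' ⟶ W}
    {αX : X' ⟶ X} {αY : Y' ⟶ Y} {αZ : Z' ⟶ Z} [Mono f] (H : IsPushout f g h i)
    (hf : IsPullback f' αW αX f) (hh : IsPullback h' αX αZ h) (hi : IsPullback i' αY αZ i)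
    (w : f' ≫ h' = g' ≫ i') (wg : g' ≫ αY = αW ≫ g) : IsPushout f' g' h' i' := by
  have hg : IsPullback g' αW αY g := by
    refine IsPullback.of_right ?_ wg hi
    rw [← w, ← H.w]
    exact hf.paste_horiz hh
  exact (Adhesive.van_kampen H f' g' h' i' αW αX αY αZ hf hg ⟨hh.w⟩ ⟨hi.w⟩ ⟨w⟩).2 ⟨hh, hi⟩

/-- Unions of subobjects are effective. -/
theorem mono_of_isPushout_of_isPullback {A B D E P : C} {a : A ⟶ B} {b : A ⟶ D} {p : B ⟶ P}
    {q : D ⟶ P} {c : B ⟶ E} {d : D ⟶ E} {e : P ⟶ E} [Mono c] [Mono d] (H : IsPushout a b p q)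
    (hP : IsPullback a b c d) (hp : p ≫ e = c) (hq : q ≫ e = d) : Mono e := by
  have h₁ : IsPushout (pullback.fst c d) (pullback.snd c d) p q := by
    refine H.of_iso hP.isoPullback (Iso.refl _) (Iso.refl _) (Iso.refl _) ?_ ?_ ?_ ?_ <;> simp
  have : Mono (pullback.fst c d) := (IsPullback.of_hasPullback c d).mono_fst_of_mono
  have h₂ : e = (h₁.isoPushout).hom ≫ pushout.desc c d pullback.condition := by
    apply h₁.hom_ext
    · simpa [hp] using (pushout.inl_desc _ _ _).symm
    · simpa [hq] using (pushout.inr_desc _ _ _).symm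
  rw [h₂]
  infer_instance

/-- Pushout complements along monomorphisms are final pullback complements. -/
theorem isFPC_of_isPushout {A B D E : C} {a : A ⟶ B} {c : B ⟶ E} {b : A ⟶ D} {d : D ⟶ E}
    [Mono a] (H : IsPushout a b c d) : IsFPC a c b d := by
  have : Mono d := Adhesive.mono_of_isPushout_of_mono_left H
  refine IsFPC.of_mono (Adhesive.isPullback_of_isPushout_of_mono_left H) fun {P Q} w y z hP => ?_
  have hY := IsPullback.of_hasPullback d z
  have hw : (w ≫ b) ≫ d = y ≫ z := by rw [← hP.w, Category.assoc, Category.assoc, H.w]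
  have h₁ : IsPullback (𝟙 P) w (w ≫ a) a := by
    refine isPullback_of_mono (by simp) fun x v _ => ⟨x, by simp⟩
  -- Pull the pushout `E` back along `z`. The preimages of both `A` and `B` are `P`, so the preimage
  -- of `D` is all of `Q`, that is, `z` factors through `d`.
  have h₂ : IsPushout (𝟙 P) (hY.lift (w ≫ b) y hw) y (pullback.snd d z) :=
    isPushout_of_isPullback H h₁ hP.flip hY.flip (by simp) (by simp)
  have := h₂.isIso_inr_of_isIso
  refine ⟨inv (pullback.snd d z) ≫ pullback.fst d z, ?_⟩
  rw [Category.assoc, hY.w, IsIso.inv_hom_id_assoc]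

/-- The final pullback complement of `K ⟶ I ⟶ H` is also one of `L ⟶ I +_K L ⟶ H`, for a
subobject `L` between `K` and that complement. -/
theorem IsFPC.of_isPushout {K I D H L I' : C} {i : K ⟶ I} {m : I ⟶ H} {k : K ⟶ D} {d : D ⟶ H}
    [Mono i] [Mono k] [Mono d] (F : IsFPC i m k d) {k' : K ⟶ L} {p : I ⟶ I'} {l : L ⟶ I'}
    (H' : IsPushout i k' p l) {n : I' ⟶ H} [Mono n] {t : L ⟶ D} (hp : p ≫ n = m)
    (ht : t ≫ d = l ≫ n) (hk : k' ≫ t = k) : IsFPC l n t d := by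
  have : Mono l := Adhesive.mono_of_isPushout_of_mono_left H'
  have hP := IsPullback.of_hasPullback n d
  refine IsFPC.of_mono (isPullback_of_mono ht.symm fun {W} x y hxy => ?_) fun {P Q} w y z hQ => ?_
  · have hK : (i ≫ p) ≫ n = k ≫ d := by rw [Category.assoc, hp, F.isPullback.w]
    have h₁ : IsPullback (hP.lift (i ≫ p) k hK) i (pullback.fst n d) p := by
      refine IsPullback.of_right (h₁₂ := pullback.snd n d) (v₁₃ := d) (h₂₂ := n) ?_ (by simp)
        hP.flip
      simpa [hp] using F.isPullback.flip
    have h₂ : IsPullback (hP.lift l t ht.symm) (𝟙 L) (pullback.fst n d) l := by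
      refine IsPullback.of_right (h₁₂ := pullback.snd n d) (v₁₃ := d) (h₂₂ := n) ?_ (by simp)
        hP.flip
      refine IsPullback.flip (isPullback_of_mono (by simp [ht]) fun x _ _ => ⟨x, by simp⟩)
    -- Pull the pushout `I'` back along the projection of `I' ×_H D`. The part over `I` shrinks to
    -- `K` and the part over `L` is `L`, so `L` is the whole pullback.
    have h₃ : IsPushout (𝟙 K) k' (hP.lift (i ≫ p) k hK) (hP.lift l t ht.symm) := by
      refine isPushout_of_isPullback H' (IsKernelPair.id_of_mono i) h₁ h₂ ?_ (by simp)
      apply hP.hom_ext <;> simp [H'.w, hk]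
    have := h₃.isIso_inr_of_isIso
    refine ⟨hP.lift x y hxy ≫ inv (hP.lift l t ht.symm), ?_⟩
    have h₄ : inv (hP.lift l t ht.symm) ≫ l = pullback.fst n d := by
      rw [IsIso.inv_comp_eq, hP.lift_fst]
    rw [Category.assoc, h₄, hP.lift_fst]
  · have hm : Mono m := by
      have : Mono p := by
        have : Mono (k' ≫ t) := by rw [hk]; infer_instance
        have : Mono k' := mono_of_mono k' t
        exact Adhesive.mono_of_isPushout_of_mono_right H'
      rw [← hp]; infer_instance
    -- A test square against `n` gives one against `m`: the preimage of `I` lies in `I` and in `L`,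
    -- hence in `K`, and the universal property of `D` applies.
    have hR := IsPullback.of_hasPullback m z
    have h₁ : (pullback.fst m z ≫ p) ≫ n = pullback.snd m z ≫ z := by
      rw [Category.assoc, hp, hR.w]
    have hK := Adhesive.isPullback_of_isPushout_of_mono_left H'
    have h₂ : pullback.fst m z ≫ p = (hQ.lift _ _ h₁ ≫ w) ≫ l := by
      rw [Category.assoc, hQ.lift_fst]
    obtain ⟨s, hs, -⟩ := F.exists_lift (hK.lift _ _ h₂) (pullback.snd m z) z (by simpa using hR)
    exact ⟨s, hs⟩

/-- Final pullback complements restrict to subobjects. -/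
theorem IsFPC.restrict {A B D E D' E' : C} {a : A ⟶ B} {c : B ⟶ E} {b : A ⟶ D} {d : D ⟶ E}
    [Mono a] [Mono c] [Mono d] (F : IsFPC a c b d) {n : E ⟶ E'} [Mono n] {b' : A ⟶ D'}
    {d' : D' ⟶ E'} [Mono d'] (F' : IsFPC a (c ≫ n) b' d') :
    ∃ t : D ⟶ D', b ≫ t = b' ∧ IsFPC d n t d' := by
  obtain ⟨t, ht, hbt⟩ := F'.exists_lift (𝟙 A) b (d ≫ n)
    (by simpa using isPullback_comp_mono F.isPullback n)
  rw [Category.id_comp] at hbt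
  refine ⟨t, hbt, IsFPC.of_mono (isPullback_of_mono ht.symm fun {W} x y hxy => ?_)
    fun {P Q} w y z hP => ?_⟩
  -- A map `x` into `E` lifts to `D` once its part over `B` lies in `A`; this holds because the
  -- image of `x` in `E'` lifts to `D'`.
  · have hR := IsPullback.of_hasPullback c x
    have h₁ : pullback.fst c x ≫ c ≫ n = (pullback.snd c x ≫ y) ≫ d' := by
      rw [← Category.assoc, hR.w, Category.assoc, hxy, Category.assoc]
    obtain ⟨s, hs, -⟩ := F.exists_lift (F'.isPullback.lift _ _ h₁) (pullback.snd c x) x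
      (by simpa using hR)
    exact ⟨s, hs⟩
  · have hR := IsPullback.of_hasPullback (c ≫ n) z
    have h₁ : (pullback.fst (c ≫ n) z ≫ c) ≫ n = pullback.snd (c ≫ n) z ≫ z := by
      rw [Category.assoc, hR.w]
    have h₂ : pullback.fst (c ≫ n) z ≫ c = (hP.lift _ _ h₁ ≫ w) ≫ d := by
      rw [Category.assoc, hP.lift_fst]
    obtain ⟨s, hs, -⟩ := F'.exists_lift (F.isPullback.lift _ _ h₂) (pullback.snd (c ≫ n) z) z
      (by simpa using hR)
    exact ⟨s, hs⟩

end FinalPullbackComplements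

/-! ### Rewriting steps and embedded double pushout diagrams -/

section Steps

variable {C : Type u} [Category.{v} C]

/-- A sesqui-pushout rewriting step: the application of the rule `r` to `H` at `m`. -/
structure Step (r : LinRule C) {H : C} (m : r.I ⟶ H) where
  D : C
  k : r.K ⟶ D
  d : D ⟶ H
  H' : C
  m' : r.O ⟶ H'
  d' : D ⟶ H'
  isFPC : IsFPC r.i m k d
  isPushout : IsPushout r.o k m' d'

/-- A double pushout diagram of the rule `r`, with monic output match `a`. -/
structure DoublePushout (r : LinRule C) where
  O' : C
  L : C
  I' : C
  a : r.O ⟶ O'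
  k : r.K ⟶ L
  p : r.I ⟶ I'
  o : L ⟶ O'
  i : L ⟶ I'
  mono_a : Mono a
  isPushout_O : IsPushout r.o k a o
  isPushout_I : IsPushout r.i k p i

/-- An embedding of a double pushout diagram into a sesqui-pushout step of the same rule. -/
structure DoublePushout.Emb {r : LinRule C} (P : DoublePushout r) {H : C} {m : r.I ⟶ H}
    (s : Step r m) where
  onO : P.O' ⟶ s.H'
  onL : P.L ⟶ s.D
  onI : P.I' ⟶ H
  mono_onO : Mono onO
  mono_onI : Mono onI
  a_onO : P.a ≫ onO = s.m'
  k_onL : P.k ≫ onL = s.k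
  p_onI : P.p ≫ onI = m
  o_onO : P.o ≫ onO = onL ≫ s.d'
  i_onI : P.i ≫ onI = onL ≫ s.d

theorem Step.mono_k {r : LinRule C} {H : C} {m : r.I ⟶ H} (s : Step r m) [Mono m] : Mono s.k := s.isFPC.isPullback.mono_snd_of_mono

variable [Adhesive C]

theorem Assumptions.nonempty_step (hC : Assumptions C) (r : LinRule C) {H : C} (m : r.I ⟶ H)
    [Mono m] : Nonempty (Step r m) := by
  obtain ⟨D, k, d, h⟩ := hC.fpc_exists r.i m inferInstance inferInstance
  exact ⟨⟨D, k, d, _, _, _, h, IsPushout.of_hasPushout r.o k⟩⟩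

namespace Step

variable {r : LinRule C} {H : C} {m : r.I ⟶ H} (s : Step r m)

theorem mono_d [Mono m] : Mono s.d := s.isFPC.mono inferInstance inferInstance

theorem mono_d' : Mono s.d' := Adhesive.mono_of_isPushout_of_mono_left s.isPushout

theorem mono_m' [Mono m] : Mono s.m' := by
  have := s.mono_k
  exact Adhesive.mono_of_isPushout_of_mono_right s.isPushout

end Step

namespace DoublePushout

variable {r : LinRule C} (P : DoublePushout r)

theorem mono_k : Mono P.k := by
  have := P.mono_a
  exact (Adhesive.isPullback_of_isPushout_of_mono_left P.isPushout_O).mono_snd_of_mono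

theorem mono_o : Mono P.o := Adhesive.mono_of_isPushout_of_mono_left P.isPushout_O

theorem mono_i : Mono P.i := Adhesive.mono_of_isPushout_of_mono_left P.isPushout_I

/-- The span in the lower row of a double pushout diagram. -/
def derived : LinRule C := ⟨P.O', P.L, P.I', P.o, P.i, P.mono_o, P.mono_i⟩

variable {P} {H : C} {m : r.I ⟶ H} {s : Step r m}

/-- A rewriting step of a rule restricts to one of any rule derived from it. -/
def Emb.step [Mono m] (E : P.Emb s) : Step P.derived E.onI where
  D := s.D
  k := E.onL
  d := s.d
  H' := s.H'
  m' := E.onO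
  d' := s.d'
  isFPC := by
    have := s.mono_k
    have := s.mono_d
    have := E.mono_onI
    exact s.isFPC.of_isPushout P.isPushout_I E.p_onI E.i_onI.symm E.k_onL
  isPushout := by
    refine IsPushout.of_top (h₁₁ := r.o) (v₁₁ := P.k) (v₁₂ := P.a) ?_ E.o_onO P.isPushout_O
    rw [E.k_onL, E.a_onO]
    exact s.isPushout

/-- The monomorphism `s.d` makes the input component determine the middle one, and `O'` is generated
by `O` and `L`. With `eq_of_onO`, either end of an embedding fixes all of it. -/
theorem Emb.eq_of_onI [Mono m] {E E' : P.Emb s} (h : E.onI = E'.onI) : E = E' := by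
  have := s.mono_d
  have hL : E.onL = E'.onL := by
    rw [← cancel_mono s.d, ← E.i_onI, ← E'.i_onI, h]
  have hO : E.onO = E'.onO := by
    apply P.isPushout_O.hom_ext
    · rw [E.a_onO, E'.a_onO]
    · rw [E.o_onO, E'.o_onO, hL]
  cases E; cases E'; simp_all

theorem Emb.eq_of_onO {E E' : P.Emb s} (h : E.onO = E'.onO) : E = E' := by
  have := s.mono_d'
  have hL : E.onL = E'.onL := by
    rw [← cancel_mono s.d', ← E.o_onO, ← E'.o_onO, h]
  have hI : E.onI = E'.onI := by
    apply P.isPushout_I.hom_ext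
    · rw [E.p_onI, E'.p_onI]
    · rw [E.i_onI, E'.i_onI, hL]
  cases E; cases E'; simp_all

/-- Finality of `s.D` provides `L ⟶ s.D`; the output component is then a pushout of this
monomorphism, hence monic. -/
theorem exists_emb_of_onI [Mono m] (P : DoublePushout r) (s : Step r m) (n : P.I' ⟶ H) (_ : Mono n)
    (hn : P.p ≫ n = m) : ∃ E : P.Emb s, E.onI = n := by
  have := P.mono_k
  have := P.mono_i
  have := s.mono_d
  obtain ⟨t, ht, hkt⟩ := s.isFPC.exists_lift (𝟙 _) P.k (P.i ≫ n) (by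
    simpa [hn] using isPullback_comp_mono
      (Adhesive.isPullback_of_isPushout_of_mono_left P.isPushout_I) n)
  rw [Category.id_comp] at hkt
  have h : r.o ≫ s.m' = P.k ≫ t ≫ s.d' := by rw [s.isPushout.w, ← hkt, Category.assoc]
  have : Mono (t ≫ s.d) := by rw [ht]; infer_instance
  have : Mono t := mono_of_mono t s.d
  have hO : IsPushout P.o t (P.isPushout_O.desc _ _ h) s.d' := by
    refine IsPushout.of_top (h₁₁ := r.o) (v₁₁ := P.k) (v₁₂ := P.a) ?_ (by simp) P.isPushout_O
    rw [hkt, IsPushout.inl_desc]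
    exact s.isPushout
  exact ⟨⟨P.isPushout_O.desc _ _ h, t, n, Adhesive.mono_of_isPushout_of_mono_right hO,
    inferInstance, by simp, hkt, hn, by simp, ht.symm⟩, rfl⟩

/-- The converse direction: `s.D` is also a final pullback complement on the output side, because
pushout complements are. The input component is monic because `I'` is the union in `H` of `I` and
`L`, which meet in `K`. -/
theorem exists_emb_of_onO [Mono m] (P : DoublePushout r) (s : Step r m) (n : P.O' ⟶ s.H')
    (_ : Mono n) (hn : P.a ≫ n = s.m') : ∃ E : P.Emb s, E.onO = n := by
  have := P.mono_k
  have := P.mono_o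
  have := s.mono_d
  have := s.mono_d'
  obtain ⟨t, ht, hkt⟩ := (isFPC_of_isPushout s.isPushout).exists_lift (𝟙 _) P.k (P.o ≫ n) (by
    simpa [hn] using isPullback_comp_mono
      (Adhesive.isPullback_of_isPushout_of_mono_left P.isPushout_O) n)
  rw [Category.id_comp] at hkt
  have h : r.i ≫ m = P.k ≫ t ≫ s.d := by rw [s.isFPC.isPullback.w, ← hkt, Category.assoc]
  have : Mono (t ≫ s.d') := by rw [ht]; infer_instance
  have : Mono t := mono_of_mono t s.d'
  have hP : IsPullback r.i P.k m (t ≫ s.d) := by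
    refine isPullback_of_mono h fun x y hxy => ?_
    exact ⟨s.isFPC.isPullback.lift x (y ≫ t) (by simpa using hxy), by simp⟩
  exact ⟨⟨n, t, P.isPushout_I.desc _ _ h, inferInstance,
    mono_of_isPushout_of_isPullback P.isPushout_I hP (by simp) (by simp), hn, hkt, by simp,
    ht.symm, by simp⟩, rfl⟩

end DoublePushout

/-- Pushout complements restrict to subobjects. -/
theorem Step.nonempty_pushoutComplement {r : LinRule C} {H : C} {m : r.I ⟶ H} (s : Step r m)
    {O' : C} {a : r.O ⟶ O'} (n : O' ⟶ s.H') [Mono n] (hn : a ≫ n = s.m') :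
    Nonempty (PushoutComplement r.o a) := by
  have := s.mono_d'
  have hY := IsPullback.of_hasPullback n s.d'
  have hw : (r.o ≫ a) ≫ n = s.k ≫ s.d' := by rw [Category.assoc, hn, s.isPushout.w]
  refine ⟨⟨_, hY.lift (r.o ≫ a) s.k hw, pullback.fst n s.d', ?_⟩⟩
  -- Restrict the pushout `s.H'` to the subobject `O'`. As `O` already lies in `O'`, only `s.D`
  -- changes, and its preimage is the required complement.
  refine isPushout_of_isPullback (αW := 𝟙 _) (αX := 𝟙 _) (αZ := n) s.isPushout
    IsPullback.of_id_snd ?_ hY (by simp) (by simp)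
  refine IsPullback.flip (isPullback_of_mono (by simp [hn]) fun x y hxy => ⟨x, by simp⟩)

end Steps

/-! ### Satisfaction of shifted and transported conditions -/

section Satisfaction

variable {C : Type u} [Category.{v} C]

theorem Condition.sat_disj {P H : C} {ι : Type (max u v)} (c : ι → Condition P) (p : P ⟶ H) :
    (Condition.disj ι c).Sat p ↔ ∃ i, (c i).Sat p := by
  simp [Condition.disj, Condition.Sat]

theorem Condition.sat_and {P H : C} (c₁ c₂ : Condition P) (p : P ⟶ H) :
    (Condition.and c₁ c₂).Sat p ↔ c₁.Sat p ∧ c₂.Sat p := by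
  simp [Condition.and, Condition.Sat, and_comm]

variable [Adhesive C]

/-- An extension of `p ≫ q` to `A` meets `Q` inside `H` in a unique overlap up to isomorphism, and
the pushout of that overlap is the union of `Q` and `A` in `H`. This selects the disjunct. -/
theorem sat_shift {P : C} (c : Condition P) {Q H : C} (p : P ⟶ Q) (q : Q ⟶ H) [Mono p] [Mono q] :
    (shift c p).Sat q ↔ c.Sat (p ≫ q) := by
  induction c generalizing Q with
  | tt => simp [shift, Condition.Sat]
  | neg c ih => simp only [shift, Condition.Sat, ih]
  | conj ι c ih => simp only [shift, Condition.Sat, ih]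
  | @ex P A a ha c ih =>
    simp only [shift, Condition.sat_disj, Condition.Sat]
    constructor
    · rintro ⟨S, e, he, rfl, hS⟩
      have : Mono (pushout.inr S.out.toQ S.out.toA) :=
        Adhesive.mono_of_isPushout_of_mono_left (IsPushout.of_hasPushout _ _)
      rw [ih] at hS
      refine ⟨_, inferInstance, ?_, hS⟩
      calc a ≫ pushout.inr S.out.toQ S.out.toA ≫ e
          = S.out.x ≫ S.out.toA ≫ pushout.inr S.out.toQ S.out.toA ≫ e := by
            rw [← Category.assoc S.out.x, S.out.x_toA]
        _ = S.out.x ≫ S.out.toQ ≫ pushout.inl S.out.toQ S.out.toA ≫ e := by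
            rw [pushout.condition_assoc]
        _ = p ≫ pushout.inl S.out.toQ S.out.toA ≫ e := by rw [← Category.assoc S.out.x, S.out.x_toQ]
    · rintro ⟨e, he, h, hc⟩
      have hX := IsPullback.of_hasPullback q e
      have hx : Mono (hX.lift p a h.symm) := by
        have : Mono (hX.lift p a h.symm ≫ pullback.fst q e) := by simpa
        exact mono_of_mono _ (pullback.fst q e)
      let S₀ : Overlap p a := ⟨_, hX.lift p a h.symm, pullback.fst q e, pullback.snd q e, hx,
        hX.mono_fst_of_mono, hX.mono_snd_of_mono, by simp, by simp⟩
      -- The disjunction uses the chosen representative of the class of `S₀`; it is again a pullback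
      -- of `q` and `e`.
      obtain ⟨S, φ, h₁, h₂⟩ : ∃ S : Quotient (Overlap.setoid p a),
          (Overlap.setoid p a).r S.out S₀ := ⟨⟦S₀⟧, Quotient.mk_out S₀⟩
      have hS : IsPullback S.out.toQ S.out.toA q e :=
        hX.of_iso φ.symm (Iso.refl _) (Iso.refl _) (Iso.refl _) (by simp [← h₁, S₀])
          (by simp [← h₂, S₀]) (by simp) (by simp)
      have hr : Mono (pushout.inr S.out.toQ S.out.toA) :=
        Adhesive.mono_of_isPushout_of_mono_left (IsPushout.of_hasPushout _ _)
      have hd : Mono (pushout.desc q e hS.w) :=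
        mono_of_isPushout_of_isPullback (IsPushout.of_hasPushout _ _) hS
          (pushout.inl_desc _ _ _) (pushout.inr_desc _ _ _)
      refine ⟨S, pushout.desc q e hS.w, hd, pushout.inl_desc _ _ _, ?_⟩
      rw [ih, pushout.inr_desc]
      exact hc

/-- Transport moves a condition from the comatch to the match. Extensions of the two correspond
through embeddings of the double pushout, and the induction continues with the derived rule, for
which `E.step` is a step with the same result. -/
theorem sat_trans {O : C} (c : Condition O) {K I : C} (o : K ⟶ O) (i : K ⟶ I) (ho : Mono o)
    (hi : Mono i) {H : C} (q : I ⟶ H) [Mono q] (s : Step ⟨O, K, I, o, i, ho, hi⟩ q) :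
    (trans c o i ho hi).Sat q ↔ c.Sat s.m' := by
  induction c generalizing K I with
  | tt => simp [trans, Condition.Sat]
  | neg c ih => simp only [trans, Condition.Sat, ih _ _ _ _ _ s]
  | conj ι c ih => simp only [trans, Condition.Sat, ih _ _ _ _ _ _ s]
  | @ex O O' a ha c ih =>
    by_cases h : Nonempty (PushoutComplement o a)
    · let P : DoublePushout ⟨O, K, I, o, i, ho, hi⟩ := ⟨O', h.some.L, _, a, h.some.k, _, h.some.l,
        _, ha, h.some.isPushout, IsPushout.of_hasPushout i h.some.k⟩
      simp only [trans, dif_pos h, Condition.Sat]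
      constructor
      · rintro ⟨q', hq', hq, hc⟩
        obtain ⟨E, rfl⟩ := P.exists_emb_of_onI s q' hq' hq
        exact ⟨E.onO, E.mono_onO, E.a_onO, (ih _ _ _ _ _ E.step).1 hc⟩
      · rintro ⟨q', hq', hq, hc⟩
        obtain ⟨E, rfl⟩ := P.exists_emb_of_onO s q' hq' hq
        have := E.mono_onI
        exact ⟨E.onI, E.mono_onI, E.p_onI, (ih _ _ _ _ _ E.step).2 hc⟩
    · simp only [trans, dif_neg h, Condition.Sat, Condition.ff, not_true, false_iff]
      rintro ⟨q', hq', hq, -⟩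
      exact h (s.nonempty_pushoutComplement q' hq)

end Satisfaction

/-! ### Functoriality of rewriting steps along monomorphisms -/

section StepHoms

variable {C : Type u} [Category.{v} C]

/-- A morphism of steps of the same rule over the monomorphism `h`. -/
structure Step.Hom {r : LinRule C} {G H : C} {m : r.I ⟶ G} {n : r.I ⟶ H} (s : Step r m)
    (t : Step r n) (h : G ⟶ H) where
  onD : s.D ⟶ t.D
  onH' : s.H' ⟶ t.H'
  mono_onH' : Mono onH'
  w : m ≫ h = n
  k_onD : s.k ≫ onD = t.k
  d_onD : s.d ≫ h = onD ≫ t.d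
  m'_onH' : s.m' ≫ onH' = t.m'
  d'_onH' : s.d' ≫ onH' = onD ≫ t.d'

variable [Adhesive C]

/-- Finality of `t.D` gives the map of complements, which is monic. The map of results is its
pushout by pasting, hence monic too. -/
theorem Step.nonempty_hom {r : LinRule C} {G H : C} {m : r.I ⟶ G} {n : r.I ⟶ H} (s : Step r m)
    (t : Step r n) (h : G ⟶ H) [Mono m] [Mono h] (w : m ≫ h = n) : Nonempty (s.Hom t h) := by
  subst w
  have := s.mono_d
  have := s.mono_d'
  obtain ⟨x, hx, hk⟩ := t.isFPC.exists_lift (𝟙 _) s.k (s.d ≫ h)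
    (by simpa using isPullback_comp_mono s.isFPC.isPullback h)
  rw [Category.id_comp] at hk
  have : Mono (x ≫ t.d) := by rw [hx]; infer_instance
  have : Mono x := mono_of_mono x t.d
  have hw : r.o ≫ t.m' = s.k ≫ x ≫ t.d' := by rw [t.isPushout.w, ← hk, Category.assoc]
  have hO : IsPushout s.d' x (s.isPushout.desc _ _ hw) t.d' := by
    refine IsPushout.of_top (h₁₁ := r.o) (v₁₁ := s.k) (v₁₂ := s.m') ?_ (by simp) s.isPushout
    rw [hk, IsPushout.inl_desc]
    exact t.isPushout
  exact ⟨⟨x, s.isPushout.desc _ _ hw, Adhesive.mono_of_isPushout_of_mono_right hO, rfl, hk, hx.symm,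
    by simp, by simp⟩⟩

end StepHoms

/-! ### Concurrency: composition diagrams and pairs of steps -/

namespace CompositionDiagram

variable {C : Type u} [Category.{v} C] {R₂ R₁ : RuleAC C} {μ : MatchSpan R₂ R₁}
  (D : CompositionDiagram μ)

/-- An embedding of a composition diagram into a step `s` of the first rule followed by a match
`m₂` of the second rule. -/
structure Emb {H : C} {m₁ : R₁.I ⟶ H} (s : Step R₁.toLinRule m₁) (m₂ : R₂.I ⟶ s.H') where
  onN : D.N ⟶ s.H'
  onL₁ : D.L₁ ⟶ s.D
  onI₂₁ : D.I₂₁ ⟶ H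
  mono_onN : Mono onN
  mono_onI₂₁ : Mono onI₂₁
  I₂N_onN : D.I₂N ≫ onN = m₂
  O₁N_onN : D.O₁N ≫ onN = s.m'
  k₁_onL₁ : D.k₁ ≫ onL₁ = s.k
  p₁_onI₂₁ : D.p₁ ≫ onI₂₁ = m₁
  L₁N_onN : D.L₁N ≫ onN = onL₁ ≫ s.d'
  L₁I₂₁_onI₂₁ : D.L₁I₂₁ ≫ onI₂₁ = onL₁ ≫ s.d

variable {D} {H : C} {m₁ : R₁.I ⟶ H} {s : Step R₁.toLinRule m₁} {m₂ : R₂.I ⟶ s.H'}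

theorem Emb.isPushout_onN (E : D.Emb s m₂) : IsPushout D.L₁N E.onL₁ E.onN s.d' := by
  refine IsPushout.of_top (h₁₁ := R₁.o) (v₁₁ := D.k₁) (v₁₂ := D.O₁N) ?_ E.L₁N_onN D.isPOC
  rw [E.k₁_onL₁, E.O₁N_onN]
  exact s.isPushout

variable [Adhesive C] (D)

theorem mono_I₂N : Mono D.I₂N := Adhesive.mono_of_isPushout_of_mono_right D.isPushout_N

theorem mono_O₁N : Mono D.O₁N := Adhesive.mono_of_isPushout_of_mono_left D.isPushout_N

/-- The part of a composition diagram that rewrites with the first rule. -/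
def doublePushout : DoublePushout R₁.toLinRule where
  O' := D.N
  L := D.L₁
  I' := D.I₂₁
  a := D.O₁N
  k := D.k₁
  p := D.p₁
  o := D.L₁N
  i := D.L₁I₂₁
  mono_a := D.mono_O₁N
  isPushout_O := D.isPOC
  isPushout_I := D.isPushout_I₂₁

theorem mono_p₁ : Mono D.p₁ := by
  have : Mono D.k₁ := D.doublePushout.mono_k
  exact Adhesive.mono_of_isPushout_of_mono_right D.isPushout_I₂₁

variable {D}

namespace Emb

/-- The underlying embedding of a double pushout diagram. -/
def toEmb (E : D.Emb s m₂) : D.doublePushout.Emb s :=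
  ⟨E.onN, E.onL₁, E.onI₂₁, E.mono_onN, E.mono_onI₂₁, E.O₁N_onN, E.k₁_onL₁, E.p₁_onI₂₁, E.L₁N_onN,
    E.L₁I₂₁_onI₂₁⟩

/-- The embedding of a composition diagram with a given underlying embedding. -/
def ofEmb (E : D.doublePushout.Emb s) (h : D.I₂N ≫ E.onO = m₂) : D.Emb s m₂ :=
  ⟨E.onO, E.onL, E.onI, E.mono_onO, E.mono_onI, h, E.a_onO, E.k_onL, E.p_onI, E.o_onO, E.i_onI⟩

theorem components_eq {n₂ : R₂.I ⟶ s.H'} (E : D.Emb s m₂) (E' : D.Emb s n₂)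
    (h : E.toEmb = E'.toEmb) : E.onN = E'.onN ∧ E.onL₁ = E'.onL₁ ∧ E.onI₂₁ = E'.onI₂₁ := by
  exact ⟨congrArg DoublePushout.Emb.onO h, congrArg DoublePushout.Emb.onL h,
    congrArg DoublePushout.Emb.onI h⟩

theorem mono_m₁ (E : D.Emb s m₂) : Mono m₁ := by
  have := D.mono_p₁
  have := E.mono_onI₂₁
  rw [← E.p₁_onI₂₁]
  infer_instance

theorem mono_m₂ (E : D.Emb s m₂) : Mono m₂ := by
  have := D.mono_I₂N
  have := E.mono_onN
  rw [← E.I₂N_onN]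
  infer_instance

instance : Subsingleton (D.Emb s m₂) where
  allEq E E' := by
    have h : E.toEmb = E'.toEmb := by
      refine DoublePushout.Emb.eq_of_onO (D.isPushout_N.hom_ext ?_ ?_)
      · exact E.I₂N_onN.trans E'.I₂N_onN.symm
      · exact E.O₁N_onN.trans E'.O₁N_onN.symm
    have h' := E.components_eq E' h
    cases E; cases E'; simp_all

/-- For a fixed step of the first rule, the match of the second is encoded in the input of the
composite. This lets matches be compared through inputs alone. -/
theorem eq_of_onI₂₁ {n₂ : R₂.I ⟶ s.H'} (E : D.Emb s m₂) (E' : D.Emb s n₂)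
    (h : E.onI₂₁ = E'.onI₂₁) : m₂ = n₂ := by
  have := E.mono_m₁
  have h' := E.components_eq E' (DoublePushout.Emb.eq_of_onI h)
  rw [← E.I₂N_onN, ← E'.I₂N_onN, h'.1]

theorem isPullback (E : D.Emb s m₂) : IsPullback μ.m₂ μ.m₁ m₂ s.m' := by
  have := E.mono_onN
  have := isPullback_comp_mono (Adhesive.isPullback_of_isPushout_of_mono_left D.isPushout_N) E.onN
  rwa [E.I₂N_onN, E.O₁N_onN] at this

end Emb

/-- The pullback condition makes `N` the union of `I₂` and `O₁` in `s.H'`, so `N` embeds there; the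
rest of the embedding follows from its output component. -/
theorem nonempty_emb_of_isPullback [Mono m₁] [Mono m₂] (D : CompositionDiagram μ)
    (h : IsPullback μ.m₂ μ.m₁ m₂ s.m') : Nonempty (D.Emb s m₂) := by
  have := s.mono_m'
  have hm : Mono (D.isPushout_N.desc _ _ h.w) :=
    mono_of_isPushout_of_isPullback D.isPushout_N h (by simp) (by simp)
  obtain ⟨E, hE⟩ := D.doublePushout.exists_emb_of_onO s (D.isPushout_N.desc _ _ h.w)
    hm (D.isPushout_N.inr_desc _ _ _)
  exact ⟨Emb.ofEmb E ((congrArg (D.I₂N ≫ ·) hE).trans (D.isPushout_N.inl_desc _ _ _))⟩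

theorem exists_emb_of_onI [Mono m₁] (D : CompositionDiagram μ) (s : Step R₁.toLinRule m₁)
    (n : D.I₂₁ ⟶ H) (hn' : Mono n) (hn : D.p₁ ≫ n = m₁) :
    ∃ (m₂ : R₂.I ⟶ s.H') (E : D.Emb s m₂), E.onI₂₁ = n := by
  obtain ⟨E, hE⟩ := D.doublePushout.exists_emb_of_onI s n hn' hn
  exact ⟨_, Emb.ofEmb E rfl, hE⟩

theorem nonempty_of_isPullback (hC : Assumptions C) [Mono m₁] [Mono m₂]
    (h : IsPullback μ.m₂ μ.m₁ m₂ s.m') : Nonempty (CompositionDiagram μ) := by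
  have := s.mono_m'
  have hN := IsPushout.of_hasPushout μ.m₂ μ.m₁
  have hI : Mono (pushout.inl μ.m₂ μ.m₁) := Adhesive.mono_of_isPushout_of_mono_right hN
  have hO : Mono (pushout.inr μ.m₂ μ.m₁) := Adhesive.mono_of_isPushout_of_mono_left hN
  have : Mono (hN.desc _ _ h.w) := mono_of_isPushout_of_isPullback hN h (by simp) (by simp)
  -- The complement of `K₁ ⟶ O₁ ⟶ N` exists because `N` embeds into the result of a step, where
  -- `s.D` is a complement.
  obtain ⟨P⟩ := s.nonempty_pushoutComplement (hN.desc _ _ h.w) (hN.inr_desc _ _ _)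
  obtain ⟨L₂, k₂, d₂, hF⟩ := hC.fpc_exists R₂.i (pushout.inl μ.m₂ μ.m₁) inferInstance hI
  have := hF.mono inferInstance hI
  exact ⟨_, _, _, hN, P.L, P.k, P.l, P.isPushout, _, _, _, IsPushout.of_hasPushout R₁.i P.k,
    L₂, k₂, d₂, hF, _, _, _, IsPushout.of_hasPushout R₂.o k₂, _, _, _,
    IsPullback.of_hasPullback d₂ P.l⟩

namespace Emb

theorem sat_iff (E : D.Emb s m₂) :
    D.composite.cI.Sat E.onI₂₁ ↔ R₁.cI.Sat m₁ ∧ R₂.cI.Sat m₂ := by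
  have := E.mono_m₁
  have := E.mono_onI₂₁
  have := E.mono_onN
  have := D.mono_p₁
  have := D.mono_I₂N
  have h : (trans (shift R₂.cI D.I₂N) D.L₁N D.L₁I₂₁ D.mono_L₁N D.mono_L₁I₂₁).Sat E.onI₂₁ ↔
      R₂.cI.Sat m₂ := by
    refine (sat_trans _ _ _ _ _ E.onI₂₁ E.toEmb.step).trans ?_
    refine (sat_shift _ D.I₂N E.onN).trans ?_
    rw [E.I₂N_onN]
  refine (Condition.sat_and _ _ _).trans ?_
  refine and_congr ?_ h
  refine (sat_shift _ D.p₁ E.onI₂₁).trans ?_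
  rw [E.p₁_onI₂₁]

/-- The complement formed in `N` sits inside the one formed in `s.H'`, and the square between them
is itself a final pullback complement. -/
theorem exists_lift (E : D.Emb s m₂) (s₂ : Step R₂.toLinRule m₂) :
    ∃ t : D.L₂ ⟶ s₂.D, D.k₂ ≫ t = s₂.k ∧ IsFPC D.L₂N E.onN t s₂.d := by
  have := E.mono_m₂
  have := E.mono_onN
  have := D.mono_I₂N
  have := D.mono_L₂N
  have := s₂.mono_d
  refine D.isFPC.restrict ?_
  rw [E.I₂N_onN]
  exact s₂.isFPC

/-- The induced morphism on the complement for the second rule. -/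
noncomputable def onL₂ (E : D.Emb s m₂) (s₂ : Step R₂.toLinRule m₂) : D.L₂ ⟶ s₂.D :=
  (E.exists_lift s₂).choose

variable (E : D.Emb s m₂) (s₂ : Step R₂.toLinRule m₂)

theorem k₂_onL₂ : D.k₂ ≫ E.onL₂ s₂ = s₂.k := (E.exists_lift s₂).choose_spec.1

theorem isFPC_onL₂ : IsFPC D.L₂N E.onN (E.onL₂ s₂) s₂.d := (E.exists_lift s₂).choose_spec.2

theorem onL₂_d : E.onL₂ s₂ ≫ s₂.d = D.L₂N ≫ E.onN := (E.isFPC_onL₂ s₂).isPullback.w.symm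

/-- The induced morphism on the output of the composite rule. -/
noncomputable def onO₂₁ : D.O₂₁ ⟶ s₂.H' :=
  D.isPushout_O₂₁.desc s₂.m' (E.onL₂ s₂ ≫ s₂.d')
    (by rw [s₂.isPushout.w, ← E.k₂_onL₂ s₂, Category.assoc])

theorem q₂_onO₂₁ : D.q₂ ≫ E.onO₂₁ s₂ = s₂.m' := D.isPushout_O₂₁.inl_desc _ _ _

theorem L₂O₂₁_onO₂₁ : D.L₂O₂₁ ≫ E.onO₂₁ s₂ = E.onL₂ s₂ ≫ s₂.d' := D.isPushout_O₂₁.inr_desc _ _ _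

theorem isPushout_onO₂₁ : IsPushout D.L₂O₂₁ (E.onL₂ s₂) (E.onO₂₁ s₂) s₂.d' := by
  refine IsPushout.of_top (h₁₁ := R₂.o) (v₁₁ := D.k₂) (v₁₂ := D.q₂) ?_ (E.L₂O₂₁_onO₂₁ s₂)
    D.isPushout_O₂₁
  rw [E.k₂_onL₂, E.q₂_onO₂₁]
  exact s₂.isPushout

theorem K₂₁_w : (D.K₂₁L₁ ≫ E.onL₁) ≫ s.d' = (D.K₂₁L₂ ≫ E.onL₂ s₂) ≫ s₂.d := by
  rw [Category.assoc, ← E.L₁N_onN, Category.assoc, E.onL₂_d, D.isPullback_K₂₁.w_assoc]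

instance hasPullback : HasPullback s.d' s₂.d := by
  have := s.mono_d'
  infer_instance

/-- The composition of two steps is a step of the composite rule. -/
noncomputable def comp : Step D.composite.toLinRule E.onI₂₁ :=
  haveI := s.mono_d'
  { D := pullback s.d' s₂.d
    k := pullback.lift _ _ (E.K₂₁_w s₂)
    d := pullback.fst s.d' s₂.d ≫ s.d
    H' := s₂.H'
    m' := E.onO₂₁ s₂
    d' := pullback.snd s.d' s₂.d ≫ s₂.d'
    isFPC := by
      have := E.mono_m₁
      have := E.mono_m₂
      have := s₂.mono_d
      have := s.mono_d
      have := s.mono_k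
      have := D.mono_L₂N
      have := D.mono_L₁N
      have := R₁.mono_i
      have := E.mono_onI₂₁
      have hP := IsPullback.of_hasPullback s.d' s₂.d
      -- The complement for the composite is stacked from two: `h₁` restricts the first step to the
      -- derived rule, and `h₂` is the complement of the second step pulled back along `s.d'`.
      have h₁ : IsFPC D.L₁I₂₁ E.onI₂₁ E.onL₁ s.d :=
        s.isFPC.of_isPushout D.isPushout_I₂₁ E.p₁_onI₂₁ E.L₁I₂₁_onI₂₁.symm E.k₁_onL₁
      have h₂ : IsFPC D.K₂₁L₁ E.onL₁ (pullback.lift _ _ (E.K₂₁_w s₂)) (pullback.fst s.d' s₂.d) :=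
        (E.isFPC_onL₂ s₂).baseChange
          (Adhesive.isPullback_of_isPushout_of_mono_left E.isPushout_onN) hP.flip
          D.isPullback_K₂₁ (pullback.lift_fst _ _ _).symm
      have := hP.mono_fst_of_mono
      exact h₁.comp h₂
    isPushout := by
      have := D.mono_L₁N
      have := E.mono_m₁
      have := E.mono_m₂
      have hP := IsPullback.of_hasPullback s.d' s₂.d
      -- Pull the pushout of `N` and `s.D` over `L₁` back along `s₂.d`; the preimages of `L₁` and
      -- `N` are `K₂₁` and `L₂`.
      have h : IsPushout D.K₂₁L₂ (pullback.lift _ _ (E.K₂₁_w s₂)) (E.onL₂ s₂)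
          (pullback.snd s.d' s₂.d) := by
        refine isPushout_of_isPullback E.isPushout_onN D.isPullback_K₂₁
          (E.isFPC_onL₂ s₂).isPullback.flip hP.flip (pullback.lift_snd _ _ _).symm
          (pullback.lift_fst _ _ _)
      exact h.paste_horiz (E.isPushout_onO₂₁ s₂) }

end Emb

namespace Emb

/-- Embeddings are preserved by morphisms of steps. -/
def map (E : D.Emb s m₂) {H' : C} {n₁ : R₁.I ⟶ H'} {t : Step R₁.toLinRule n₁} {h : H ⟶ H'} [Mono h]
    (x : s.Hom t h) {n₂ : R₂.I ⟶ t.H'} (hm : m₂ ≫ x.onH' = n₂) : D.Emb t n₂ where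
  onN := E.onN ≫ x.onH'
  onL₁ := E.onL₁ ≫ x.onD
  onI₂₁ := E.onI₂₁ ≫ h
  mono_onN := @mono_comp _ _ _ _ _ _ E.mono_onN _ x.mono_onH'
  mono_onI₂₁ := @mono_comp _ _ _ _ _ _ E.mono_onI₂₁ _ inferInstance
  I₂N_onN := by rw [← hm, ← Category.assoc, E.I₂N_onN]
  O₁N_onN := by rw [← Category.assoc, E.O₁N_onN, x.m'_onH']
  k₁_onL₁ := by rw [← Category.assoc, E.k₁_onL₁, x.k_onD]
  p₁_onI₂₁ := by rw [← Category.assoc, E.p₁_onI₂₁, x.w]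
  L₁N_onN := by rw [← Category.assoc, E.L₁N_onN, Category.assoc, Category.assoc, x.d'_onH']
  L₁I₂₁_onI₂₁ := by rw [← Category.assoc, E.L₁I₂₁_onI₂₁, Category.assoc, Category.assoc, x.d_onD]

/-- Embeddings are reflected by morphisms of steps. -/
theorem nonempty_of_hom {H' : C} {n₁ : R₁.I ⟶ H'} {t : Step R₁.toLinRule n₁} {h : H ⟶ H'}
    (x : s.Hom t h) {n₂ : R₂.I ⟶ t.H'} (E : D.Emb t n₂) (hm : m₂ ≫ x.onH' = n₂) :
    Nonempty (D.Emb s m₂) := by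
  have := E.mono_m₁
  have := E.mono_m₂
  have := x.mono_onH'
  have : Mono (m₁ ≫ h) := by rw [x.w]; infer_instance
  have : Mono m₁ := mono_of_mono m₁ h
  have : Mono (m₂ ≫ x.onH') := by rw [hm]; infer_instance
  have : Mono m₂ := mono_of_mono m₂ x.onH'
  -- An embedding exists exactly when `μ` is the pullback of the match and the comatch, and a
  -- monomorphism after both does not affect this.
  refine D.nonempty_emb_of_isPullback (isPullback_of_comp_mono (e := x.onH') ?_)
  rw [hm, x.m'_onH']
  exact E.isPullback

/-- Composition of steps is functorial. -/
theorem exists_hom_comp (E : D.Emb s m₂) (s₂ : Step R₂.toLinRule m₂) {H' : C} {n₁ : R₁.I ⟶ H'}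
    {t : Step R₁.toLinRule n₁} {h : H ⟶ H'} [Mono h] (x : s.Hom t h) {n₂ : R₂.I ⟶ t.H'}
    (E' : D.Emb t n₂) (t₂ : Step R₂.toLinRule n₂) (x₂ : s₂.Hom t₂ x.onH') :
    ∃ y : (E.comp s₂).Hom (E'.comp t₂) h, y.onH' = x₂.onH' := by
  -- Embeddings for given matches are unique, so `E'` is the image of `E`.
  obtain rfl : E.map x x₂.w = E' := Subsingleton.elim _ _
  set E' := E.map x x₂.w
  have := E'.mono_m₁
  have := E'.mono_m₂
  have := t.mono_d
  have := t.mono_d'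
  have := t₂.mono_d
  have hP := IsPullback.of_hasPullback t.d' t₂.d
  have hw : (pullback.fst s.d' s₂.d ≫ x.onD) ≫ t.d' = (pullback.snd s.d' s₂.d ≫ x₂.onD) ≫ t₂.d := by
    rw [Category.assoc, ← x.d'_onH', Category.assoc, ← x₂.d_onD, pullback.condition_assoc]
  have hd : (pullback.fst s.d' s₂.d ≫ s.d) ≫ h =
      hP.lift _ _ hw ≫ pullback.fst t.d' t₂.d ≫ t.d := by
    rw [← Category.assoc (hP.lift _ _ hw), hP.lift_fst, Category.assoc, Category.assoc, x.d_onD]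
  have hd' : (pullback.snd s.d' s₂.d ≫ s₂.d') ≫ x₂.onH' =
      hP.lift _ _ hw ≫ pullback.snd t.d' t₂.d ≫ t₂.d' := by
    rw [← Category.assoc (hP.lift _ _ hw), hP.lift_snd, Category.assoc, Category.assoc, x₂.d'_onH']
  have hL : E.onL₂ s₂ ≫ x₂.onD = E'.onL₂ t₂ := by
    rw [← cancel_mono t₂.d, Category.assoc, ← x₂.d_onD, ← Category.assoc, E.onL₂_d, E'.onL₂_d,
      Category.assoc]
    rfl
  have hk : pullback.lift _ _ (E.K₂₁_w s₂) ≫ hP.lift _ _ hw = pullback.lift _ _ (E'.K₂₁_w t₂) := by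
    have := hP.mono_fst_of_mono
    rw [← cancel_mono (pullback.fst t.d' t₂.d), Category.assoc, hP.lift_fst, pullback.lift_fst,
      ← Category.assoc, pullback.lift_fst, Category.assoc]
    rfl
  have hm : E.onO₂₁ s₂ ≫ x₂.onH' = E'.onO₂₁ t₂ := by
    apply D.isPushout_O₂₁.hom_ext
    · rw [← Category.assoc, E.q₂_onO₂₁, E'.q₂_onO₂₁, x₂.m'_onH']
    · rw [← Category.assoc, E.L₂O₂₁_onO₂₁, E'.L₂O₂₁_onO₂₁, Category.assoc, x₂.d'_onH', ← hL,
        Category.assoc]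
  exact ⟨⟨hP.lift _ _ hw, x₂.onH', x₂.mono_onH', rfl, hk, hd, hm, hd'⟩, rfl⟩

end Emb
end CompositionDiagram

/-! ### Admissible matches up to isomorphism -/

section AdmissibleMatches

variable {C : Type u} [Category.{v} C] [Adhesive C] {R₂ R₁ : RuleAC C}

/-- The composition diagram that defines the composite along an admissible match. -/
noncomputable def AdmissibleMatch.diagram (μ : AdmissibleMatch R₂ R₁) :
    CompositionDiagram (Quotient.out μ).1 := (Quotient.out μ).2.choose

theorem AdmissibleMatch.exists_sat (μ : AdmissibleMatch R₂ R₁) :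
    ∃ (H : C) (n : (comp R₂ R₁ μ).I ⟶ H), Mono n ∧ (comp R₂ R₁ μ).cI.Sat n := by
  have h := (Quotient.out μ).2.choose_spec
  simp only [Condition.Equivalent, Condition.ff, Condition.Sat, not_forall] at h
  obtain ⟨H, n, hn, h⟩ := h
  refine ⟨H, n, hn, ?_⟩
  by_contra h'
  exact h (iff_of_false h' (not_not_intro trivial))

variable {μ : AdmissibleMatch R₂ R₁} {H : C} {m₁ : R₁.I ⟶ H} {s : Step R₁.toLinRule m₁}
  {m₂ : R₂.I ⟶ s.H'}

namespace AdmissibleMatch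

/-- The embedding of the input of the first rule into that of the composite. -/
noncomputable def p (μ : AdmissibleMatch R₂ R₁) : R₁.I ⟶ (comp R₂ R₁ μ).I := μ.diagram.p₁

theorem mono_p (μ : AdmissibleMatch R₂ R₁) : Mono μ.p := μ.diagram.mono_p₁

/-- Embeddings of the composition diagram of an admissible match. -/
def Emb (μ : AdmissibleMatch R₂ R₁) {H : C} {m₁ : R₁.I ⟶ H} (s : Step R₁.toLinRule m₁)
    (m₂ : R₂.I ⟶ s.H') : Type v := μ.diagram.Emb s m₂

/-- Both spans are pullbacks of `m₂` and the comatch. -/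
theorem eq_of_emb {ν : AdmissibleMatch R₂ R₁} (E : μ.Emb s m₂) (E' : ν.Emb s m₂) : μ = ν := by
  have h := CompositionDiagram.Emb.isPullback E
  have h' := CompositionDiagram.Emb.isPullback E'
  refine Quotient.out_equiv_out.1 ⟨h.isoIsPullback _ _ h', ?_, ?_⟩ <;> simp

theorem exists_emb_of_onI [Mono m₁] (μ : AdmissibleMatch R₂ R₁) (s : Step R₁.toLinRule m₁)
    (n : (comp R₂ R₁ μ).I ⟶ H) [hn : Mono n] (h : μ.p ≫ n = m₁) :
    ∃ (m₂ : R₂.I ⟶ s.H') (E : μ.Emb s m₂), CompositionDiagram.Emb.onI₂₁ E = n :=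
  μ.diagram.exists_emb_of_onI s n hn h

namespace Emb

instance : Subsingleton (μ.Emb s m₂) :=
  inferInstanceAs (Subsingleton (μ.diagram.Emb s m₂))

theorem eq (E E' : μ.Emb s m₂) : E = E' := Subsingleton.elim E E'

/-- The embedding of the input of the composite rule. -/
def onI (E : μ.Emb s m₂) : (comp R₂ R₁ μ).I ⟶ H := CompositionDiagram.Emb.onI₂₁ E

theorem mono_onI (E : μ.Emb s m₂) : Mono E.onI := CompositionDiagram.Emb.mono_onI₂₁ E

theorem mono_m₂ (E : μ.Emb s m₂) : Mono m₂ := CompositionDiagram.Emb.mono_m₂ E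

theorem p_onI (E : μ.Emb s m₂) : μ.p ≫ E.onI = m₁ := CompositionDiagram.Emb.p₁_onI₂₁ E

theorem eq_of_onI {n₂ : R₂.I ⟶ s.H'} (E : μ.Emb s m₂) (E' : μ.Emb s n₂) (h : E.onI = E'.onI) :
    m₂ = n₂ := CompositionDiagram.Emb.eq_of_onI₂₁ E E' h

theorem sat_iff (E : μ.Emb s m₂) :
    (comp R₂ R₁ μ).cI.Sat E.onI ↔ R₁.cI.Sat m₁ ∧ R₂.cI.Sat m₂ := CompositionDiagram.Emb.sat_iff E

/-- The composite of two steps, as a step of the composite rule. -/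
noncomputable def comp (E : μ.Emb s m₂) (s₂ : Step R₂.toLinRule m₂) :
    Step (SqPO.comp R₂ R₁ μ).toLinRule E.onI := CompositionDiagram.Emb.comp E s₂

/-- Embeddings are preserved by morphisms of steps. -/
noncomputable def map (E : μ.Emb s m₂) {H' : C} {n₁ : R₁.I ⟶ H'} {t : Step R₁.toLinRule n₁} {h : H ⟶ H'} [Mono h]
    (x : s.Hom t h) {n₂ : R₂.I ⟶ t.H'} (hm : m₂ ≫ x.onH' = n₂) : μ.Emb t n₂ :=
  CompositionDiagram.Emb.map E x hm

theorem nonempty_of_hom {H' : C} {n₁ : R₁.I ⟶ H'} {t : Step R₁.toLinRule n₁} {h : H ⟶ H'}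
    (x : s.Hom t h) {n₂ : R₂.I ⟶ t.H'} (E : μ.Emb t n₂) (hm : m₂ ≫ x.onH' = n₂) :
    Nonempty (μ.Emb s m₂) := CompositionDiagram.Emb.nonempty_of_hom x E hm

theorem exists_hom_comp (E : μ.Emb s m₂) (s₂ : Step R₂.toLinRule m₂) {H' : C} {n₁ : R₁.I ⟶ H'}
    {t : Step R₁.toLinRule n₁} {h : H ⟶ H'} [Mono h] (x : s.Hom t h) {n₂ : R₂.I ⟶ t.H'}
    (E' : μ.Emb t n₂) (t₂ : Step R₂.toLinRule n₂) (x₂ : s₂.Hom t₂ x.onH') :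
    ∃ y : (E.comp s₂).Hom (E'.comp t₂) h, y.onH' = x₂.onH' :=
  CompositionDiagram.Emb.exists_hom_comp E s₂ x E' t₂ x₂

end Emb

end AdmissibleMatch

/-- The overlap is the pullback of `m₂` and the comatch. Its diagram embeds into the step, and the
satisfied conditions make the composite condition hold at this embedding, which witnesses
admissibility. -/
theorem Assumptions.exists_admissibleMatch (hC : Assumptions C) (_ : Mono m₁) (_ : Mono m₂)
    (h₁ : R₁.cI.Sat m₁) (h₂ : R₂.cI.Sat m₂) :
    ∃ μ : AdmissibleMatch R₂ R₁, Nonempty (μ.Emb s m₂) := by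
  have := s.mono_m'
  have hP := IsPullback.of_hasPullback m₂ s.m'
  let μ₀ : MatchSpan R₂ R₁ := ⟨_, _, _, hP.mono_fst_of_mono, hP.mono_snd_of_mono⟩
  obtain ⟨D⟩ := CompositionDiagram.nonempty_of_isPullback (μ := μ₀) hC hP
  obtain ⟨E⟩ := D.nonempty_emb_of_isPullback hP
  have hμ : IsAdmissible μ₀ :=
    ⟨D, fun h => (h _ E.onI₂₁ E.mono_onI₂₁).1 (E.sat_iff.2 ⟨h₁, h₂⟩) trivial⟩
  let μ : AdmissibleMatch R₂ R₁ := Quotient.mk _ ⟨μ₀, hμ⟩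
  obtain ⟨φ, hφ₂, hφ₁⟩ : (admissibleSetoid R₂ R₁).r (Quotient.out μ) ⟨μ₀, hμ⟩ := Quotient.mk_out _
  refine ⟨μ, μ.diagram.nonempty_emb_of_isPullback (hP.of_iso φ.symm (Iso.refl _) (Iso.refl _)
    (Iso.refl _) ?_ ?_ (by simp) (by simp))⟩
  · rw [Iso.refl_hom, Category.comp_id]
    exact (Iso.eq_inv_comp φ).2 hφ₂
  · rw [Iso.refl_hom, Category.comp_id]
    exact (Iso.eq_inv_comp φ).2 hφ₁

end AdmissibleMatches

/-! ### Traces and the comparison of two families indexing them -/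

section Traces

variable {C : Type u} [Category.{v} C]

/-- Two successive rewriting steps starting at `H`, by `R₁` and by `R₂`, and a match of `R₃` into
the result. -/
structure Trace (R₃ R₂ R₁ : RuleAC C) (H : C) where
  m₁ : R₁.I ⟶ H
  mono_m₁ : Mono m₁
  s₁ : Step R₁.toLinRule m₁
  m₂ : R₂.I ⟶ s₁.H'
  mono_m₂ : Mono m₂
  s₂ : Step R₂.toLinRule m₂
  m₃ : R₃.I ⟶ s₂.H'
  mono_m₃ : Mono m₃

variable {R₃ R₂ R₁ : RuleAC C}

/-- All matches of a trace satisfy the application conditions. -/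
def Trace.Sat {H : C} (T : Trace R₃ R₂ R₁ H) : Prop :=
  R₁.cI.Sat T.m₁ ∧ R₂.cI.Sat T.m₂ ∧ R₃.cI.Sat T.m₃

/-- A morphism of traces over `h`. -/
structure Trace.Hom {G H : C} (T : Trace R₃ R₂ R₁ G) (U : Trace R₃ R₂ R₁ H) (h : G ⟶ H) where
  x₁ : T.s₁.Hom U.s₁ h
  x₂ : T.s₂.Hom U.s₂ x₁.onH'
  w₃ : T.m₃ ≫ x₂.onH' = U.m₃

variable (R₃ R₂ R₁) in
/-- A family of objects with conditions such that every satisfying trace contains the object of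
exactly one member, and every trace that contains it is induced by its embedding. -/
structure TraceFamily where
  X : Type (max u v)
  I : X → C
  cond : (x : X) → Condition (I x)
  Embeds : (x : X) → {H : C} → Trace R₃ R₂ R₁ H → (I x ⟶ H) → Prop
  unique : ∀ {x : X} {H : C} {T : Trace R₃ R₂ R₁ H} {n n' : I x ⟶ H},
    Embeds x T n → Embeds x T n' → n = n'
  mono : ∀ {x : X} {H : C} {T : Trace R₃ R₂ R₁ H} {n : I x ⟶ H}, Embeds x T n → Mono n
  map : ∀ {x : X} {G H : C} {T : Trace R₃ R₂ R₁ G} {U : Trace R₃ R₂ R₁ H} {h : G ⟶ H} {n : I x ⟶ G},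
    Mono h → T.Hom U h → Embeds x T n → Embeds x U (n ≫ h)
  restrict : ∀ {x : X} {G H : C} {T : Trace R₃ R₂ R₁ G} {U : Trace R₃ R₂ R₁ H} {h : G ⟶ H}
    {n : I x ⟶ H}, Mono h → T.Hom U h → Embeds x U n → ∃ n', Embeds x T n'
  nonempty_hom : ∀ {x : X} {G H : C} {T : Trace R₃ R₂ R₁ G} {U : Trace R₃ R₂ R₁ H} {h : G ⟶ H}
    {n : I x ⟶ G}, Mono h → Embeds x T n → Embeds x U (n ≫ h) → Nonempty (T.Hom U h)
  exists_trace : ∀ (x : X) {H : C} (n : I x ⟶ H), Mono n → ∃ T : Trace R₃ R₂ R₁ H, Embeds x T n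
  eq_of_embeds : ∀ {x y : X} {H : C} {T : Trace R₃ R₂ R₁ H} {n : I x ⟶ H} {n' : I y ⟶ H},
    Embeds x T n → Embeds y T n' → x = y
  exists_of_sat : ∀ {H : C} (T : Trace R₃ R₂ R₁ H), T.Sat → ∃ (x : X) (n : I x ⟶ H), Embeds x T n
  exists_sat : ∀ x : X, ∃ (H : C) (n : I x ⟶ H), Mono n ∧ (cond x).Sat n
  sat_iff : ∀ {x : X} {H : C} {T : Trace R₃ R₂ R₁ H} {n : I x ⟶ H}, Embeds x T n →
    ((cond x).Sat n ↔ T.Sat)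

namespace TraceFamily

variable (F G : TraceFamily R₃ R₂ R₁)

/-- Two members of families are related if they embed into a common trace. -/
def Rel (x : F.X) (y : G.X) : Prop :=
  ∃ (H : C) (T : Trace R₃ R₂ R₁ H) (n : F.I x ⟶ H) (n' : G.I y ⟶ H), F.Embeds x T n ∧ G.Embeds y T n'

variable {F G}

theorem Rel.symm {x : F.X} {y : G.X} : F.Rel G x y → G.Rel F y x := by
  rintro ⟨H, T, n, n', h, h'⟩
  exact ⟨H, T, n', n, h', h⟩

/-- A morphism satisfying the condition of `x` gives a satisfying trace, and this contains some
member of `G`. -/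
theorem exists_rel (x : F.X) : ∃ y : G.X, F.Rel G x y := by
  obtain ⟨H, n, hn, hs⟩ := F.exists_sat x
  obtain ⟨T, hT⟩ := F.exists_trace x n hn
  obtain ⟨y, n', h⟩ := G.exists_of_sat T ((F.sat_iff hT).1 hs)
  exact ⟨y, H, T, n, n', hT, h⟩

/-- Of two related members, one embeds into every trace over the other. -/
theorem Rel.exists_embeds {x : F.X} {y : G.X} (h : F.Rel G x y) {H : C} {T : Trace R₃ R₂ R₁ H}
    {n : G.I y ⟶ H} (hT : G.Embeds y T n) : ∃ n' : F.I x ⟶ H, F.Embeds x T n' := by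
  obtain ⟨K, U, k, k', hk, hk'⟩ := h
  -- `V`, the trace on the input of `y` itself, maps to every trace containing `y`. The embedding of
  -- `x` is restricted from the common trace `U` to `V` and then pushed forward to `T`.
  obtain ⟨V, hV⟩ := G.exists_trace y (𝟙 _) inferInstance
  obtain ⟨f⟩ := G.nonempty_hom (h := k') (G.mono hk') hV (by simpa using hk')
  obtain ⟨g⟩ := G.nonempty_hom (h := n) (G.mono hT) hV (by simpa using hT)
  obtain ⟨l, hl⟩ := F.restrict (G.mono hk') f hk
  exact ⟨_, F.map (G.mono hT) g hl⟩

theorem Rel.left_unique {x x' : F.X} {y : G.X} (h : F.Rel G x y) (h' : F.Rel G x' y) : x = x' := by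
  obtain ⟨H, T, n, n', hn, hn'⟩ := h
  obtain ⟨k, hk⟩ := h'.exists_embeds hn'
  exact F.eq_of_embeds hn hk

variable (F G) in
theorem exists_equiv : ∃ Φ : F.X ≃ G.X, ∀ x, F.Rel G x (Φ x) := by
  choose f hf using fun x : F.X => exists_rel (G := G) x
  choose g hg using fun y : G.X => exists_rel (F := G) (G := F) y
  exact ⟨⟨f, g, fun x => (hg (f x)).symm.left_unique (hf x),
    fun y => (hf (g y)).symm.left_unique (hg y)⟩, hf⟩

/-- Each input embeds into the trace on the other. One composite is the identity by uniqueness of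
embeddings into a trace, the other by cancelling the monomorphism `n`. -/
theorem Rel.exists_iso {x : F.X} {y : G.X} (h : F.Rel G x y) :
    ∃ (ι : F.I x ≅ G.I y) (T : Trace R₃ R₂ R₁ (G.I y)), F.Embeds x T ι.hom ∧ G.Embeds y T (𝟙 _) := by
  obtain ⟨T, hT⟩ := G.exists_trace y (𝟙 _) inferInstance
  obtain ⟨U, hU⟩ := F.exists_trace x (𝟙 _) inferInstance
  obtain ⟨n, hn⟩ := h.exists_embeds hT
  obtain ⟨k, hk⟩ := h.symm.exists_embeds hU
  have := F.mono hn
  obtain ⟨f⟩ := F.nonempty_hom (h := n) inferInstance hU (by simpa using hn)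
  have h₁ : k ≫ n = 𝟙 _ := G.unique (G.map inferInstance f hk) hT
  have h₂ : n ≫ k = 𝟙 _ := by rw [← cancel_mono n, Category.assoc, h₁]; simp
  exact ⟨⟨n, k, h₂, h₁⟩, T, hn, hT⟩

/-- The trace induced by `q` contains both members, so each condition at `q` amounts to satisfaction
of that trace. -/
theorem equivalentAlong {x : F.X} {y : G.X} {ι : F.I x ≅ G.I y} {T : Trace R₃ R₂ R₁ (G.I y)}
    (h : F.Embeds x T ι.hom) (h' : G.Embeds y T (𝟙 _)) :
    Condition.EquivalentAlong ι (F.cond x) (G.cond y) := by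
  intro H q hq
  obtain ⟨U, hU⟩ := G.exists_trace y q hq
  obtain ⟨f⟩ := G.nonempty_hom hq h' (by simpa using hU)
  exact (F.sat_iff (F.map hq f h)).trans (G.sat_iff hU).symm

end TraceFamily

end Traces

/-! ### The two bracketings as families of traces, and the isomorphism of rules -/

section Associativity

variable {C : Type u} [Category.{v} C]

-- Along an isomorphism `m`, pullback and pushout make `k` and `m'` isomorphisms: the lower row of
-- the step is then a copy of the rule.
theorem Step.isIso_k {r : LinRule C} {H : C} {m : r.I ⟶ H} (s : Step r m) [IsIso m] : IsIso s.k :=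
  s.isFPC.isPullback.isIso_snd_of_isIso

theorem Step.isIso_m' {r : LinRule C} {H : C} {m : r.I ⟶ H} (s : Step r m) [IsIso m] :
    IsIso s.m' := by
  have := s.isIso_k
  exact s.isPushout.isIso_inl_of_isIso

/-- Rules with isomorphic steps along isomorphisms are isomorphic. -/
theorem Step.exists_linRuleIso {r r' : LinRule C} {H : C} {m : r.I ⟶ H} {n : r'.I ⟶ H}
    (s : Step r m) (t : Step r' n) (φ : s.D ≅ t.D) (ψ : s.H' ≅ t.H') (hd : φ.hom ≫ t.d = s.d)
    (hd' : φ.hom ≫ t.d' = s.d' ≫ ψ.hom) [IsIso m] [IsIso n] (ι : r.I ≅ r'.I) (hι : ι.hom ≫ n = m) :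
    ∃ e : r.Iso r', e.ι = ι := by
  have := s.isIso_k
  have := t.isIso_k
  have := s.isIso_m'
  have := t.isIso_m'
  refine ⟨⟨asIso s.m' ≪≫ ψ ≪≫ (asIso t.m').symm, asIso s.k ≪≫ φ ≪≫ (asIso t.k).symm, ι, ?_, ?_⟩, rfl⟩
  · rw [← cancel_mono t.m']
    simp [s.isPushout.w_assoc, t.isPushout.w, hd']
  · rw [← cancel_mono n]
    simp [t.isFPC.isPullback.w, hd, hι, s.isFPC.isPullback.w]

variable [Adhesive C] {R₃ R₂ R₁ : RuleAC C}

/-- Embeddings of a member of `MatchesA` into a trace. -/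
structure EmbA (α : MatchesA R₃ R₂ R₁) {H : C} (T : Trace R₃ R₂ R₁ H) where
  inner : α.1.Emb T.s₁ T.m₂
  outer : α.2.Emb (inner.comp T.s₂) T.m₃

/-- Embeddings of a member of `MatchesB` into a trace. -/
structure EmbB (β : MatchesB R₃ R₂ R₁) {H : C} (T : Trace R₃ R₂ R₁ H) where
  inner : β.1.Emb T.s₂ T.m₃
  outer : β.2.Emb T.s₁ inner.onI

instance (α : MatchesA R₃ R₂ R₁) {H : C} (T : Trace R₃ R₂ R₁ H) : Subsingleton (EmbA α T) where
  allEq := by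
    rintro ⟨i, o⟩ ⟨i', o'⟩
    obtain rfl : i = i' := i.eq i'
    obtain rfl : o = o' := AdmissibleMatch.Emb.eq o o'
    rfl

instance (β : MatchesB R₃ R₂ R₁) {H : C} (T : Trace R₃ R₂ R₁ H) : Subsingleton (EmbB β T) where
  allEq := by
    rintro ⟨i, o⟩ ⟨i', o'⟩
    obtain rfl : i = i' := i.eq i'
    obtain rfl : o = o' := AdmissibleMatch.Emb.eq o o'
    rfl

namespace EmbA

variable {α : MatchesA R₃ R₂ R₁} {G H : C} {T : Trace R₃ R₂ R₁ G} {U : Trace R₃ R₂ R₁ H} {h : G ⟶ H}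

theorem map (E : EmbA α T) (x : T.Hom U h) [Mono h] :
    ∃ E' : EmbA α U, E'.outer.onI = E.outer.onI ≫ h := by
  obtain ⟨y, hy⟩ := E.inner.exists_hom_comp T.s₂ x.x₁ (E.inner.map x.x₁ x.x₂.w) U.s₂ x.x₂
  exact ⟨⟨E.inner.map x.x₁ x.x₂.w, E.outer.map y ((congrArg (T.m₃ ≫ ·) hy).trans x.w₃)⟩, rfl⟩

theorem restrict (E : EmbA α U) (x : T.Hom U h) [Mono h] : Nonempty (EmbA α T) := by
  obtain ⟨E₁⟩ := E.inner.nonempty_of_hom x.x₁ x.x₂.w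
  obtain ⟨y, hy⟩ := E₁.exists_hom_comp T.s₂ x.x₁ E.inner U.s₂ x.x₂
  obtain ⟨E₂⟩ := E.outer.nonempty_of_hom y ((congrArg (T.m₃ ≫ ·) hy).trans x.w₃)
  exact ⟨⟨E₁, E₂⟩⟩

theorem nonempty_hom (E : EmbA α T) (E' : EmbA α U) [Mono h]
    (w : E.outer.onI ≫ h = E'.outer.onI) : Nonempty (T.Hom U h) := by
  have := T.mono_m₁
  have := T.mono_m₂
  have hI : E.inner.onI ≫ h = E'.inner.onI := by
    rw [← E.outer.p_onI, ← E'.outer.p_onI, Category.assoc, w]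
  obtain ⟨x₁⟩ := T.s₁.nonempty_hom U.s₁ h
    (by rw [← E.inner.p_onI, ← E'.inner.p_onI, Category.assoc, hI])
  have := x₁.mono_onH'
  -- The inputs agree over `h`, so the matches they encode agree; the same argument with the outer
  -- embeddings gives `h₃`.
  have h₂ : T.m₂ ≫ x₁.onH' = U.m₂ := (E.inner.map x₁ rfl).eq_of_onI E'.inner hI
  obtain ⟨x₂⟩ := T.s₂.nonempty_hom U.s₂ x₁.onH' h₂
  obtain ⟨y, hy⟩ := E.inner.exists_hom_comp T.s₂ x₁ E'.inner U.s₂ x₂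
  have h₃ : T.m₃ ≫ y.onH' = U.m₃ := (E.outer.map y rfl).eq_of_onI E'.outer w
  exact ⟨⟨x₁, x₂, (congrArg (T.m₃ ≫ ·) hy.symm).trans h₃⟩⟩

theorem exists_trace (hC : Assumptions C) (α : MatchesA R₃ R₂ R₁)
    (n : (comp R₃ (comp R₂ R₁ α.1) α.2).I ⟶ H) [Mono n] :
    ∃ (T : Trace R₃ R₂ R₁ H) (E : EmbA α T), E.outer.onI = n := by
  have h₁ := α.1.mono_p
  have h₂ := α.2.mono_p
  have h₃ : Mono (α.2.p ≫ n) := @mono_comp _ _ _ _ _ _ h₂ _ _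
  have h₄ : Mono (α.1.p ≫ α.2.p ≫ n) := @mono_comp _ _ _ _ _ _ h₁ _ h₃
  -- The trace is read off from `n`: its restriction to `I₂₁` encodes `m₁` and `m₂`, and `n` itself
  -- encodes `m₃` relative to the composed step.
  obtain ⟨s₁⟩ := hC.nonempty_step R₁.toLinRule (α.1.p ≫ α.2.p ≫ n)
  obtain ⟨m₂, E₁, hE₁⟩ := α.1.exists_emb_of_onI s₁ (α.2.p ≫ n) rfl
  have h₅ := E₁.mono_m₂
  obtain ⟨s₂⟩ := hC.nonempty_step R₂.toLinRule m₂
  have h₆ := E₁.mono_onI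
  obtain ⟨m₃, E₂, hE₂⟩ := α.2.exists_emb_of_onI (m₁ := E₁.onI)
    (E₁.comp s₂) n hE₁.symm
  exact ⟨⟨_, h₄, s₁, m₂, h₅, s₂, m₃, E₂.mono_m₂⟩, ⟨E₁, E₂⟩, hE₂⟩

theorem eq_of_embeds {α' : MatchesA R₃ R₂ R₁} (E : EmbA α T) (E' : EmbA α' T) : α = α' := by
  obtain ⟨μ, ν⟩ := α
  obtain ⟨μ', ν'⟩ := α'
  obtain rfl : μ = μ' := AdmissibleMatch.eq_of_emb E.inner E'.inner
  obtain ⟨i, o⟩ := E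
  obtain ⟨i', o'⟩ := E'
  obtain rfl : i = i' := i.eq i'
  obtain rfl : ν = ν' := AdmissibleMatch.eq_of_emb o o'
  rfl

theorem sat_iff (E : EmbA α T) :
    (comp R₃ (comp R₂ R₁ α.1) α.2).cI.Sat E.outer.onI ↔ T.Sat :=
  E.outer.sat_iff.trans ((and_congr_left' E.inner.sat_iff).trans and_assoc)

theorem exists_of_sat (hC : Assumptions C) (T : Trace R₃ R₂ R₁ H) (hT : T.Sat) :
    ∃ α : MatchesA R₃ R₂ R₁, Nonempty (EmbA α T) := by
  obtain ⟨μ, ⟨E₁⟩⟩ := hC.exists_admissibleMatch T.mono_m₁ T.mono_m₂ hT.1 hT.2.1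
  obtain ⟨ν, ⟨E₂⟩⟩ := hC.exists_admissibleMatch (R₁ := comp R₂ R₁ μ) (m₁ := E₁.onI)
    (s := E₁.comp T.s₂) (m₂ := T.m₃) E₁.mono_onI T.mono_m₃
    (E₁.sat_iff.2 ⟨hT.1, hT.2.1⟩) hT.2.2
  exact ⟨⟨μ, ν⟩, ⟨⟨E₁, E₂⟩⟩⟩

end EmbA

namespace EmbB

variable {β : MatchesB R₃ R₂ R₁} {G H : C} {T : Trace R₃ R₂ R₁ G} {U : Trace R₃ R₂ R₁ H} {h : G ⟶ H}

theorem map (E : EmbB β T) (x : T.Hom U h) [Mono h] :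
    ∃ E' : EmbB β U, E'.outer.onI = E.outer.onI ≫ h := by
  have := x.x₁.mono_onH'
  exact ⟨⟨E.inner.map x.x₂ x.w₃, E.outer.map x.x₁ rfl⟩, rfl⟩

theorem restrict (E : EmbB β U) (x : T.Hom U h) [Mono h] : Nonempty (EmbB β T) := by
  have := x.x₁.mono_onH'
  obtain ⟨E₁⟩ := E.inner.nonempty_of_hom x.x₂ x.w₃
  have h₁ : E₁.map x.x₂ x.w₃ = E.inner := Subsingleton.elim _ _
  obtain ⟨E₂⟩ := E.outer.nonempty_of_hom x.x₁ (m₂ := E₁.onI)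
    (congrArg AdmissibleMatch.Emb.onI h₁)
  exact ⟨⟨E₁, E₂⟩⟩

theorem nonempty_hom (E : EmbB β T) (E' : EmbB β U) [Mono h]
    (w : E.outer.onI ≫ h = E'.outer.onI) : Nonempty (T.Hom U h) := by
  have := T.mono_m₁
  have := T.mono_m₂
  obtain ⟨x₁⟩ := T.s₁.nonempty_hom U.s₁ h
    (by rw [← E.outer.p_onI, ← E'.outer.p_onI, Category.assoc, w])
  have := x₁.mono_onH'
  have hI : E.inner.onI ≫ x₁.onH' = E'.inner.onI :=
    (E.outer.map x₁ rfl).eq_of_onI E'.outer w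
  have h₂ : T.m₂ ≫ x₁.onH' = U.m₂ := by
    rw [← E.inner.p_onI, ← E'.inner.p_onI, Category.assoc, hI]
  obtain ⟨x₂⟩ := T.s₂.nonempty_hom U.s₂ x₁.onH' h₂
  exact ⟨⟨x₁, x₂, (E.inner.map x₂ rfl).eq_of_onI E'.inner hI⟩⟩

theorem exists_trace (hC : Assumptions C) (β : MatchesB R₃ R₂ R₁)
    (n : (comp (comp R₃ R₂ β.1) R₁ β.2).I ⟶ H) [Mono n] :
    ∃ (T : Trace R₃ R₂ R₁ H) (E : EmbB β T), E.outer.onI = n := by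
  have h₁ := β.1.mono_p
  have h₂ := β.2.mono_p
  have h₃ : Mono (β.2.p ≫ n) := @mono_comp _ _ _ _ _ _ h₂ _ _
  obtain ⟨s₁⟩ := hC.nonempty_step R₁.toLinRule (β.2.p ≫ n)
  -- Here `n` first yields a match `m` of the composite of `R₃` with `R₂`, which is then decoded
  -- into `m₂` and `m₃`.
  obtain ⟨m, E₂, hE₂⟩ := β.2.exists_emb_of_onI s₁ n rfl
  have h₄ := E₂.mono_m₂
  have h₅ : Mono (β.1.p ≫ m) := @mono_comp _ _ _ _ _ _ h₁ _ h₄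
  obtain ⟨s₂⟩ := hC.nonempty_step R₂.toLinRule (β.1.p ≫ m)
  obtain ⟨m₃, E₁, hE₁⟩ := β.1.exists_emb_of_onI s₂ m rfl
  -- `E₂` belongs to the match `m`; `hE₁` carries it over to `E₁.onI`.
  obtain ⟨E₂', hE₂'⟩ : ∃ E : β.2.Emb s₁ E₁.onI, E.onI = n := by
    have h : ∀ m', m' = m → ∃ E : β.2.Emb s₁ m', E.onI = n := by
      rintro _ rfl
      exact ⟨E₂, hE₂⟩
    exact h _ hE₁
  exact ⟨⟨_, h₃, s₁, _, h₅, s₂, m₃, E₁.mono_m₂⟩, ⟨E₁, E₂'⟩, hE₂'⟩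

theorem eq_of_embeds {β' : MatchesB R₃ R₂ R₁} (E : EmbB β T) (E' : EmbB β' T) : β = β' := by
  obtain ⟨μ, ν⟩ := β
  obtain ⟨μ', ν'⟩ := β'
  obtain rfl : μ = μ' := AdmissibleMatch.eq_of_emb E.inner E'.inner
  obtain ⟨i, o⟩ := E
  obtain ⟨i', o'⟩ := E'
  obtain rfl : i = i' := i.eq i'
  obtain rfl : ν = ν' := AdmissibleMatch.eq_of_emb o o'
  rfl

theorem sat_iff (E : EmbB β T) :
    (comp (comp R₃ R₂ β.1) R₁ β.2).cI.Sat E.outer.onI ↔ T.Sat :=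
  E.outer.sat_iff.trans (and_congr_right' E.inner.sat_iff)

theorem exists_of_sat (hC : Assumptions C) (T : Trace R₃ R₂ R₁ H) (hT : T.Sat) :
    ∃ β : MatchesB R₃ R₂ R₁, Nonempty (EmbB β T) := by
  obtain ⟨μ, ⟨E₁⟩⟩ := hC.exists_admissibleMatch T.mono_m₂ T.mono_m₃ hT.2.1 hT.2.2
  obtain ⟨ν, ⟨E₂⟩⟩ := hC.exists_admissibleMatch (R₂ := comp R₃ R₂ μ) (s := T.s₁)
    (m₂ := E₁.onI) T.mono_m₁ E₁.mono_onI hT.1 (E₁.sat_iff.2 hT.2)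
  exact ⟨⟨μ, ν⟩, ⟨⟨E₁, E₂⟩⟩⟩

end EmbB

variable (R₃ R₂ R₁) in
/-- The composites `R₃ ◁ (R₂ ◁ R₁)` as a family of traces. -/
noncomputable def familyA (hC : Assumptions C) : TraceFamily R₃ R₂ R₁ where
  X := MatchesA R₃ R₂ R₁
  I α := (comp R₃ (comp R₂ R₁ α.1) α.2).I
  cond α := (comp R₃ (comp R₂ R₁ α.1) α.2).cI
  Embeds α _ T n := ∃ E : EmbA α T, E.outer.onI = n
  unique := by
    rintro α H T _ _ ⟨E, rfl⟩ ⟨E', rfl⟩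
    rw [Subsingleton.elim E E']
  mono := by
    rintro α H T _ ⟨E, rfl⟩
    exact E.outer.mono_onI
  map := by
    rintro α G H T U h _ hh x ⟨E, rfl⟩
    exact E.map x
  restrict := by
    rintro α G H T U h _ hh x ⟨E, rfl⟩
    obtain ⟨E'⟩ := E.restrict x
    exact ⟨_, E', rfl⟩
  nonempty_hom := by
    rintro α G H T U h _ hh ⟨E, rfl⟩ ⟨E', hE'⟩
    exact E.nonempty_hom E' hE'.symm
  exists_trace α H n hn := EmbA.exists_trace hC α n
  eq_of_embeds := by
    rintro α α' H T _ _ ⟨E, -⟩ ⟨E', -⟩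
    exact E.eq_of_embeds E'
  exists_of_sat T hT := by
    obtain ⟨α, ⟨E⟩⟩ := EmbA.exists_of_sat hC T hT
    exact ⟨α, _, E, rfl⟩
  exists_sat α := α.2.exists_sat
  sat_iff := by
    rintro α H T _ ⟨E, rfl⟩
    exact E.sat_iff

variable (R₃ R₂ R₁) in
/-- The composites `(R₃ ◁ R₂) ◁ R₁` as a family of traces. -/
noncomputable def familyB (hC : Assumptions C) : TraceFamily R₃ R₂ R₁ where
  X := MatchesB R₃ R₂ R₁
  I β := (comp (comp R₃ R₂ β.1) R₁ β.2).I
  cond β := (comp (comp R₃ R₂ β.1) R₁ β.2).cI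
  Embeds β _ T n := ∃ E : EmbB β T, E.outer.onI = n
  unique := by
    rintro β H T _ _ ⟨E, rfl⟩ ⟨E', rfl⟩
    rw [Subsingleton.elim E E']
  mono := by
    rintro β H T _ ⟨E, rfl⟩
    exact E.outer.mono_onI
  map := by
    rintro β G H T U h _ hh x ⟨E, rfl⟩
    exact E.map x
  restrict := by
    rintro β G H T U h _ hh x ⟨E, rfl⟩
    obtain ⟨E'⟩ := E.restrict x
    exact ⟨_, E', rfl⟩
  nonempty_hom := by
    rintro β G H T U h _ hh ⟨E, rfl⟩ ⟨E', hE'⟩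
    exact E.nonempty_hom E' hE'.symm
  exists_trace β H n hn := EmbB.exists_trace hC β n
  eq_of_embeds := by
    rintro β β' H T _ _ ⟨E, -⟩ ⟨E', -⟩
    exact E.eq_of_embeds E'
  exists_of_sat T hT := by
    obtain ⟨β, ⟨E⟩⟩ := EmbB.exists_of_sat hC T hT
    exact ⟨β, _, E, rfl⟩
  exists_sat β := β.2.exists_sat
  sat_iff := by
    rintro β H T _ ⟨E, rfl⟩
    exact E.sat_iff

theorem exists_linRuleIso (hC : Assumptions C) {α : MatchesA R₃ R₂ R₁} {β : MatchesB R₃ R₂ R₁}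
    {H : C} {T : Trace R₃ R₂ R₁ H} (E : EmbA α T) (E' : EmbB β T) [IsIso E.outer.onI]
    [IsIso E'.outer.onI]
    (ι : (comp R₃ (comp R₂ R₁ α.1) α.2).I ≅ (comp (comp R₃ R₂ β.1) R₁ β.2).I)
    (hι : ι.hom ≫ E'.outer.onI = E.outer.onI) :
    ∃ e : (comp R₃ (comp R₂ R₁ α.1) α.2).toLinRule.Iso (comp (comp R₃ R₂ β.1) R₁ β.2).toLinRule,
      e.ι = ι := by
  have := T.mono_m₃
  have := T.s₁.mono_d'
  have := T.s₂.mono_d'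
  obtain ⟨s₃⟩ := hC.nonempty_step R₃.toLinRule T.m₃
  let s := E.outer.comp s₃
  let t := E'.outer.comp (E'.inner.comp s₃)
  have h₁ : HasPullback (pullback.snd T.s₁.d' T.s₂.d ≫ T.s₂.d') s₃.d :=
    CompositionDiagram.Emb.hasPullback (s := E.inner.comp T.s₂) s₃
  -- Both derivations end in `s₃.H'`, and their middle objects are the two bracketings of the
  -- iterated pullback of the three complements over the intermediate results.
  let φ : s.D ≅ t.D := pullbackAssoc T.s₁.d' T.s₂.d T.s₂.d' s₃.d
  refine s.exists_linRuleIso t φ (Iso.refl s₃.H') ?_ ?_ ι hι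
  · exact pullbackAssoc_hom_fst_assoc ..
  · exact (pullbackAssoc_hom_snd_snd_assoc ..).trans (Category.comp_id _).symm

end Associativity

end SqPO

theorem mainTheorem2 {C : Type u} [Category.{v} C] [Adhesive C] (hC : SqPO.Assumptions C)
    (R₁ R₂ R₃ : SqPO.RuleAC C) :
    ∃ Φ : SqPO.MatchesA R₃ R₂ R₁ ≃ SqPO.MatchesB R₃ R₂ R₁,
      ∀ α : SqPO.MatchesA R₃ R₂ R₁,
        ∃ e : SqPO.LinRule.Iso
            (SqPO.comp R₃ (SqPO.comp R₂ R₁ α.1) α.2).toLinRule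
            (SqPO.comp (SqPO.comp R₃ R₂ (Φ α).1) R₁ (Φ α).2).toLinRule,
          SqPO.Condition.EquivalentAlong e.ι
            (SqPO.comp R₃ (SqPO.comp R₂ R₁ α.1) α.2).cI
            (SqPO.comp (SqPO.comp R₃ R₂ (Φ α).1) R₁ (Φ α).2).cI := by
  obtain ⟨Φ, hΦ⟩ := SqPO.TraceFamily.exists_equiv (SqPO.familyA R₃ R₂ R₁ hC)
    (SqPO.familyB R₃ R₂ R₁ hC)
  refine ⟨Φ, fun α => ?_⟩
  obtain ⟨ι, T, h, h'⟩ := (hΦ α).exists_iso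
  have hS := SqPO.TraceFamily.equivalentAlong h h'
  obtain ⟨E, hE⟩ := h
  obtain ⟨E', hE'⟩ := h'
  have h₁ : IsIso E.outer.onI := by rw [hE]; exact ι.isIso_hom
  have h₂ : IsIso E'.outer.onI := by rw [hE']; exact IsIso.id _
  obtain ⟨e, he⟩ := SqPO.exists_linRuleIso hC E E' ι (by rw [hE, hE']; exact Category.comp_id _)
  refine ⟨e, ?_⟩
  rw [he]
  exact hS
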